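/- **Setting.** Let $S\subseteq\mathbb R^n$ be nonempty, convex and compact, let $g:\mathbb R^s\to\overline{\mathbb R}$ and $f:\mathbb R^p\to\overline{\mathbb R}$ be proper, convex and lower semicontinuous, let $A:\mathbb R^n\to\mathbb R^s$ and $K:\mathbb R^n\to\mathbb R^p$ be linear, and let $\varphi:\mathbb R^n\to\mathbb R$ be differentiable with $\ell_{\nabla\varphi}$-Lipschitz gradient. Consider the structured DC program $$\min_{x\in S}\ g(Ax)+\varphi(x)-f(Kx).\qquad (P)$$ All norms are Euclidean, $g^*,f^*$ are the Fenchel conjugates, $A^*,K^*$ the adjoints, $\sigma_A$ is the maximal eigenvalue of $A^*A$, $\iota_S$ is the indicator function and $N_S=\partial\iota_S$ the normal cone of $S$. For a convex function $h$, $\partial_\varepsilon h(\bar x)=\{v: h(x)\ge h(\bar x)+\langle v,x-\bar x\rangle-\varepsilon\ \forall x\}$ if $h(\bar x)\in\mathbb R$ (empty otherwise), and $\partial h=\partial_0h$. For a nonconvex $h$, $\partial h$ is the limiting subdifferential, and $\operatorname{dom}\partial h=\{x:\partial h(x)\ne\emptyset\}$. For $t>0$ let $\mathcal K_t=\{v\in\mathbb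 R^s:\operatorname{dist}(v,A(S))\le t\}$. A triple $(\bar x,\bar y,\bar z)$ is an *$\varepsilon$-approximate KKT point* of $(P)$ if $$A\bar x\in\partial_\varepsilon g^*(\bar z),\qquad K\bar x\in\partial f^*(\bar y),\qquad K^*\bar y\in A^*\bar z+\nabla\varphi(\bar x)+N_S(\bar x).$$ **Assumptions.** 1. $A(S)\subseteq\operatorname{ri}(\operatorname{dom}g)$ and $\inf_{x\in S}\{g(Ax)+\varphi(x)-f(Kx)\}>-\infty$. 2. $K(S)\subseteq\operatorname{ri}(\operatorname{dom}f)$, and there is $r>0$ with $\mathcal K_r\subseteq\operatorname{int}(\operatorname{dom}g)$; $\ell_{g,\mathcal K_r}>0$ is a Lipschitz constant of $g$ on $\mathcal K_r$. 3. $g$ is essentially strictly convex (strictly convex on every nonempty convex subset of $\operatorname{dom}\partial g$) and $\operatorname{int}(\operatorname{dom}f)\ne\emptyset$. **Algorithm (Adaptive DPFS).** Let $0<\alpha<\gamma/2$, $\mu>0$, $\varepsilon>0$ and $0<\underline\beta\le\beta_k\le\overline\beta<\infty$ for all $k\ge 0$. Let $(a_j)_{j\ge0}$ be a nonincreasing sequence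 with $a_0=\alpha+\gamma$, $a_j>\alpha$, $a_j\to\alpha$, $$\frac{a_j-a_{j+1}}{(a_{j+1}-\alpha)(a_j-\alpha)}\le\frac1\gamma,\qquad (a_j-\alpha)(a_{j+2}-\alpha)\ge(a_{j+1}-\alpha)^2\qquad(j\ge0).$$ From a starting point $(x^0,y^0,z^0)$, with $\alpha_0=a_0$, iterate for $k=0,1,2,\dots$ $$x^{k+1}=\operatorname{Proj}_S\!\Big(x^k+\tfrac1{\rho_k}\big(-\nabla\varphi(x^k)+K^*y^k-A^*z^k\big)\Big),$$ $$y^{k+1}=\arg\min_y\Big\{f^*(y)+\tfrac{\beta_k}2\big\|y-y^k-\tfrac1{\beta_k}Kx^{k+1}\big\|^2\Big\},$$ $$z^{k+1}=\arg\min_z\Big\{g^*(z)+\tfrac{\alpha_k}2\big\|z-\delta_kz^k-\tfrac1{\alpha_k}Ax^{k+1}\big\|^2\Big\},$$ where $\delta_k=\alpha/\alpha_k$ and $\rho_k=\frac{\ell_{\nabla\varphi}}2+\frac{3\sigma_A\gamma}{2(\alpha_k-\alpha)^2}+\mu$. If $(\alpha_k-\alpha)\|z^{k+1}\|>\varepsilon$,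 then $\alpha_{k+1}$ is the term of $(a_j)$ that follows the one used as $\alpha_k$; otherwise $\alpha_{k+1}=\alpha_k$. **Merit function.** Under the hypotheses below, the parameters $\alpha_k$ are eventually equal to a constant $\widetilde\alpha>\alpha$. Put $$\varpi(x,y,z,u)=\langle z,Ax\rangle-g^*(z)+\varphi(x)+\iota_S(x)-\langle Kx,y\rangle+f^*(y)+\tfrac\alpha2\Big(1+\tfrac{4\alpha}{\widetilde\alpha-\alpha}\Big)\|z-u\|^2-\tfrac12(\widetilde\alpha-\alpha)\|z\|^2 .$$ A function $h$ has the *Kurdyka–Łojasiewicz (KL) property* at $\hat w\in\operatorname{dom}\partial h$ if there are $\eta\in(0,+\infty]$, an open neighbourhood $U$ of $\hat w$ and a concave continuous $\phi:[0,\eta)\to[0,+\infty)$ with $\phi(0)=0$, $\phi\in C^1(0,\eta)$ and $\phi'>0$ on $(0,\eta)$, such that $\phi'(h(w)-h(\hat w))\operatorname{dist}(0,\partial h(w))\ge1$ for all $w\in U$ with $h(\hat w)<h(w)<h(\hat w)+\eta$ (where $\operatorname{dist}(0,\emptyset)=+\infty$). **Theorem.** Let Assumptions 1–3 hold, let $0<\gamma\le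 2r/\ell_{g,\mathcal K_r}$, $\|z^0\|\le\ell_{g,\mathcal K_r}$ and $0<\varepsilon\le r$, and let $\ell_{g,\mathcal K_\varepsilon}$ be a Lipschitz constant of $g$ on $\mathcal K_\varepsilon$. Let $(x^k,y^k,z^k)_{k\ge0}$ be generated by Adaptive DPFS, and suppose that $\varpi$ has the KL property at every point of $\operatorname{dom}\partial\varpi$. Then $(x^k,y^k,z^k)_{k\ge0}$ converges, and its limit is a $(2\,\ell_{g,\mathcal K_\varepsilon}\,\varepsilon)$-approximate KKT point of $(P)$. -/

import Mathlib

open Set Filter Topology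
open scoped RealInnerProductSpace NNReal ENNReal

namespace DPFS

/-- The Euclidean space of dimension `n`. -/
abbrev E (n : ℕ) : Type := EuclideanSpace ℝ (Fin n)

noncomputable section

/-! ### Extended-real-valued functions and subdifferentials -/

section Convex

variable {H : Type*} [NormedAddCommGroup H] [InnerProductSpace ℝ H]

/-- Effective domain. -/
def dom (h : H → EReal) : Set H := {x | h x < ⊤}

/-- Proper: nonempty effective domain and never `-∞`. -/
def Proper (h : H → EReal) : Prop := (dom h).Nonempty ∧ ∀ x, h x ≠ ⊥

/-- Convexity of an extended-real-valued function: its epigraph is convex. -/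
def ConvexFun (h : H → EReal) : Prop := Convex ℝ {q : H × ℝ | h q.1 ≤ (q.2 : EReal)}

/-- The indicator function of a set: `0` on the set and `+∞` off it. -/
def indicatorFun (C : Set H) : H → EReal := by
  classical
  exact fun x => if x ∈ C then 0 else ⊤

/-- The Fenchel conjugate. -/
def conj (h : H → EReal) : H → EReal := fun v => ⨆ x : H, ((⟪v, x⟫ : ℝ) : EReal) - h x

/-- The `ε`-subdifferential (of a convex function); empty where `h` is not finite. -/
def epsSubdiff (ε : ℝ) (h : H → EReal) (x₀ : H) : Set H :=
  {v | h x₀ ≠ ⊤ ∧ h x₀ ≠ ⊥ ∧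
    ∀ x : H, h x₀ + ((⟪v, x - x₀⟫ - ε : ℝ) : EReal) ≤ h x}

/-- The convex subdifferential. -/
def convSubdiff (h : H → EReal) (x₀ : H) : Set H := epsSubdiff 0 h x₀

/-- The normal cone: the convex subdifferential of the indicator function. -/
def normalCone (C : Set H) (x₀ : H) : Set H := convSubdiff (indicatorFun C) x₀

/-- Essentially strictly convex: proper, and strictly convex on every (nonempty) convex subset of
the domain of the convex subdifferential. -/
def EssStrictlyConvex (h : H → EReal) : Prop :=
  Proper h ∧
    ∀ C : Set H, C.Nonempty → Convex ℝ C → C ⊆ {x | (convSubdiff h x).Nonempty} →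
      ∀ x ∈ C, ∀ y ∈ C, x ≠ y → ∀ a b : ℝ, 0 < a → 0 < b → a + b = 1 →
        h (a • x + b • y) < (a : EReal) * h x + (b : EReal) * h y

/-- The Fréchet subdifferential; empty where `h` is not finite. -/
def frechetSubdiff (h : H → EReal) (x₀ : H) : Set H :=
  {v | h x₀ ≠ ⊤ ∧ h x₀ ≠ ⊥ ∧
    0 ≤ liminf (fun x : H =>
      (h x - h x₀ - ((⟪v, x - x₀⟫ : ℝ) : EReal)) / ((‖x - x₀‖ : ℝ) : EReal)) (𝓝[≠] x₀)}

/-- The limiting subdifferential; empty where `h` is not finite. -/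
def limSubdiff (h : H → EReal) (x₀ : H) : Set H :=
  {v | h x₀ ≠ ⊤ ∧ h x₀ ≠ ⊥ ∧
    ∃ (xs vs : ℕ → H), Tendsto xs atTop (𝓝 x₀) ∧
      Tendsto (fun k => h (xs k)) atTop (𝓝 (h x₀)) ∧
      Tendsto vs atTop (𝓝 v) ∧ ∀ k, vs k ∈ frechetSubdiff h (xs k)}

/-- The Kurdyka-Łojasiewicz property of `h` at `x₀`. The half-open interval `[0, η)`, with
`η ∈ (0, +∞]`, is `{s | 0 ≤ s ∧ s < η}`. The distance to the empty set is `+∞`. -/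
def HasKLAt (h : H → EReal) (x₀ : H) : Prop :=
  ∃ (η : EReal) (U : Set H) (ψ : ℝ → ℝ),
    0 < η ∧ IsOpen U ∧ x₀ ∈ U ∧
    ConcaveOn ℝ {s : ℝ | 0 ≤ s ∧ (s : EReal) < η} ψ ∧
    ContinuousOn ψ {s : ℝ | 0 ≤ s ∧ (s : EReal) < η} ∧
    (∀ s : ℝ, 0 ≤ s → (s : EReal) < η → 0 ≤ ψ s) ∧
    ψ 0 = 0 ∧
    (∀ s : ℝ, 0 < s → (s : EReal) < η → DifferentiableAt ℝ ψ s ∧ 0 < deriv ψ s) ∧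
    ContinuousOn (deriv ψ) {s : ℝ | 0 < s ∧ (s : EReal) < η} ∧
    ∀ x ∈ U, h x₀ < h x → h x < h x₀ + η →
      1 ≤ ENNReal.ofReal (deriv ψ ((h x).toReal - (h x₀).toReal)) *
        Metric.infEDist (0 : H) (limSubdiff h x)

/-- `q` is the projection of `w` onto `C`. -/
def IsProj (C : Set H) (w q : H) : Prop := q ∈ C ∧ ∀ c ∈ C, ‖w - q‖ ≤ ‖w - c‖

/-- `q` is the value at `w` of the proximal mapping of `h` with parameter `t`. -/
def IsProx (h : H → EReal) (t : ℝ) (w q : H) : Prop :=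
  ∀ u : H, h q + ((1 / (2 * t) * ‖q - w‖ ^ 2 : ℝ) : EReal)
    ≤ h u + ((1 / (2 * t) * ‖u - w‖ ^ 2 : ℝ) : EReal)

end Convex

/-! ### The structured DC program -/

section Program

variable {n p s : ℕ}

/-- The maximal eigenvalue of `A* A` (it is `0` on the zero space). -/
def sigmaMax (A : E n →L[ℝ] E s) : ℝ :=
  sSup {t : ℝ | Module.End.HasEigenvalue
    ((ContinuousLinearMap.adjoint A ∘L A : E n →L[ℝ] E n) : E n →ₗ[ℝ] E n) t}

/-- `σ_A = ‖A‖²`. -/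
theorem sigmaMax_eq (A : E n →L[ℝ] E s) : sigmaMax A = ‖A‖ ^ 2 := by
  have key : ∀ v : E n, ⟪v, ContinuousLinearMap.adjoint A (A v)⟫ = ‖A v‖ ^ 2 := fun v => by
    rw [ContinuousLinearMap.adjoint_inner_right, real_inner_self_eq_norm_sq]
  unfold sigmaMax
  rcases subsingleton_or_nontrivial (E n) with hs | hs
  · have hA : A = 0 := by
      ext v
      rw [Subsingleton.elim v 0]
      simp
    have he : {t : ℝ | Module.End.HasEigenvalue
        ((ContinuousLinearMap.adjoint A ∘L A : E n →L[ℝ] E n) : E n →ₗ[ℝ] E n) t} = ∅ := by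
      ext t
      simp only [mem_ofPred_eq, mem_empty_iff_false, iff_false]
      intro h
      obtain ⟨v, hv⟩ := h.exists_hasEigenvector
      exact hv.2 (Subsingleton.elim _ _)
    rw [he, hA]
    simp
  · apply IsGreatest.csSup_eq
    constructor
    · obtain ⟨v, hv, hmax⟩ := (isCompact_sphere (0 : E n) 1).exists_isMaxOn
        (NormedSpace.sphere_nonempty.2 zero_le_one)
        (f := fun v => ‖A v‖) (by fun_prop)
      have hv1 : ‖v‖ = 1 := by simpa using hv
      have hAv : ‖A v‖ = ‖A‖ := by
        apply le_antisymm
        · simpa [hv1] using A.le_opNorm v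
        · refine A.opNorm_le_of_unit_norm (norm_nonneg _) fun u hu => ?_
          exact hmax (by simpa using hu)
      have hle : ‖ContinuousLinearMap.adjoint A (A v)‖ ≤ ‖A‖ ^ 2 := by
        have := (ContinuousLinearMap.adjoint A).le_opNorm (A v)
        rw [LinearIsometryEquiv.norm_map, hAv] at this
        nlinarith
      have hz : ContinuousLinearMap.adjoint A (A v) - (‖A‖ ^ 2) • v = 0 := by
        rw [← norm_eq_zero, ← sq_eq_zero_iff]
        apply le_antisymm _ (sq_nonneg _)
        rw [norm_sub_sq_real, inner_smul_right, real_inner_comm, key, hAv, norm_smul, hv1]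
        rw [Real.norm_of_nonneg (by positivity)]
        have h0 := norm_nonneg (ContinuousLinearMap.adjoint A (A v))
        nlinarith
      refine Module.End.hasEigenvalue_of_hasEigenvector (x := v) ⟨?_, ?_⟩
      · rw [Module.End.mem_eigenspace_iff]
        exact sub_eq_zero.1 hz
      · intro h
        simp [h] at hv1
    · intro t ht
      obtain ⟨v, hv⟩ := Module.End.HasEigenvalue.exists_hasEigenvector ht
      have h1 : ContinuousLinearMap.adjoint A (A v) = t • v := hv.apply_eq_smul
      have h2 := key v
      rw [h1, inner_smul_right, real_inner_self_eq_norm_sq] at h2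
      have h3 : ‖A v‖ ^ 2 ≤ ‖A‖ ^ 2 * ‖v‖ ^ 2 := by
        rw [← mul_pow]
        exact pow_le_pow_left₀ (norm_nonneg _) (A.le_opNorm v) 2
      have h4 : 0 < ‖v‖ ^ 2 := by
        have := norm_pos_iff.2 hv.2
        positivity
      rw [← h2] at h3
      exact le_of_mul_le_mul_right h3 h4

/-- The objective `g(Ax) + φ(x) - f(Kx)`. -/
def objective (g : E s → EReal) (φ : E n → ℝ) (f : E p → EReal)
    (A : E n →L[ℝ] E s) (K : E n →L[ℝ] E p) (x : E n) : EReal :=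
  g (A x) + (φ x : EReal) - f (K x)

/-- `ε`-approximate KKT points of the program `min_{x ∈ S} g(Ax) + φ(x) - f(Kx)`. -/
def IsApproxKKT (S : Set (E n)) (g : E s → EReal) (φ : E n → ℝ) (f : E p → EReal)
    (A : E n →L[ℝ] E s) (K : E n →L[ℝ] E p) (ε : ℝ) (x : E n) (y : E p) (z : E s) : Prop :=
  A x ∈ epsSubdiff ε (conj g) z ∧
  K x ∈ convSubdiff (conj f) y ∧
  ∃ ν ∈ normalCone S x,
    ContinuousLinearMap.adjoint K y = ContinuousLinearMap.adjoint A z + gradient φ x + ν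

/-- The closed `r`-neighbourhood `{z | dist(z, A(S)) ≤ r}` of `A(S)`. -/
def nbhd (S : Set (E n)) (A : E n →L[ℝ] E s) (r : ℝ) : Set (E s) :=
  {z | Metric.infDist z (A '' S) ≤ r}

/-- The product `ℝⁿ × ℝᵖ × ℝˢ × ℝˢ` with its Euclidean norm. -/
abbrev Quad (n p s : ℕ) : Type :=
  WithLp 2 (E n × WithLp 2 (E p × WithLp 2 (E s × E s)))

/-- `⟨z, Ax⟩ - g*(z) + φ(x) + ι_S(x) - ⟨Kx, y⟩ + f*(y)`. -/
def Psi (S : Set (E n)) (g : E s → EReal) (φ : E n → ℝ) (f : E p → EReal)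
    (A : E n →L[ℝ] E s) (K : E n →L[ℝ] E p) (x : E n) (y : E p) (z : E s) : EReal :=
  ((⟪z, A x⟫ : ℝ) : EReal) - conj g z + (φ x : EReal) + indicatorFun S x
    - ((⟪K x, y⟫ : ℝ) : EReal) + conj f y

/-- The merit function, at `w = (x, y, z, u)`, for the parameters `α` and `αt > α`. -/
def merit (S : Set (E n)) (g : E s → EReal) (φ : E n → ℝ) (f : E p → EReal)
    (A : E n →L[ℝ] E s) (K : E n →L[ℝ] E p) (α αt : ℝ) (w : Quad n p s) : EReal :=
  Psi S g φ f A K w.fst w.snd.fst w.snd.snd.fst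
    + ((α / 2 * (1 + 4 * α / (αt - α)) * ‖w.snd.snd.fst - w.snd.snd.snd‖ ^ 2
        - 1 / 2 * (αt - α) * ‖w.snd.snd.fst‖ ^ 2 : ℝ) : EReal)

/-! ### Adaptive DPFS -/

/-- The conditions on the sequence of values through which the parameter `α_k` is lowered. -/
structure IsStepRule (α γ : ℝ) (a : ℕ → ℝ) : Prop where
  init : a 0 = α + γ
  anti : ∀ j, a (j + 1) ≤ a j
  gt : ∀ j, α < a j
  lim : Tendsto a atTop (𝓝 α)
  ratio : ∀ j, (a j - a (j + 1)) / ((a (j + 1) - α) * (a j - α)) ≤ 1 / γ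
  logConvex : ∀ j, (a (j + 1) - α) ^ 2 ≤ (a j - α) * (a (j + 2) - α)

/-- The number of parameter updates made before iteration `k`: after iteration `k` an update takes
place exactly when `(α_k - α) ‖z^{k+1}‖ > ε`, where `α_k` is the current value of the rule `a`. -/
def updateCount (α ε : ℝ) (a : ℕ → ℝ) (z : ℕ → E s) : ℕ → ℕ
  | 0 => 0
  | k + 1 =>
    if ε < (a (updateCount α ε a z k) - α) * ‖z (k + 1)‖
    then updateCount α ε a z k + 1
    else updateCount α ε a z k

/-- The parameter `α_k` of the algorithm. -/
def alphaSeq (α ε : ℝ) (a : ℕ → ℝ) (z : ℕ → E s) (k : ℕ) : ℝ := a (updateCount α ε a z k)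

/-- The parameter `ρ` that belongs to the value `αk` of the parameter `α_k`. -/
def rhoOf (ℓφ σA γ μ α αk : ℝ) : ℝ :=
  ℓφ / 2 + 3 * σA * γ / (2 * (αk - α) ^ 2) + μ

/-- `(x^k, y^k, z^k)` is generated by Adaptive DPFS with the step rule `a` and the parameters
`β_k`; here `δ_k = α / α_k` and `ρ_k` is `rhoOf` of `α_k`. -/
structure IsAdaptiveDPFS (S : Set (E n)) (g : E s → EReal) (φ : E n → ℝ) (f : E p → EReal)
    (A : E n →L[ℝ] E s) (K : E n →L[ℝ] E p) (ℓφ α γ μ ε : ℝ) (a β : ℕ → ℝ)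
    (x : ℕ → E n) (y : ℕ → E p) (z : ℕ → E s) : Prop where
  x_step : ∀ k, IsProj S
    (x k + (1 / rhoOf ℓφ (sigmaMax A) γ μ α (alphaSeq α ε a z k)) •
      (-gradient φ (x k) + ContinuousLinearMap.adjoint K (y k)
        - ContinuousLinearMap.adjoint A (z k)))
    (x (k + 1))
  y_step : ∀ k, IsProx (conj f) (1 / β k) (y k + (1 / β k) • K (x (k + 1))) (y (k + 1))
  z_step : ∀ k, IsProx (conj g) (1 / alphaSeq α ε a z k)
    ((α / alphaSeq α ε a z k) • z k + (1 / alphaSeq α ε a z k) • A (x (k + 1)))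
    (z (k + 1))

end Program

end

end DPFS

/-!
The dual variables stay bounded: `z^{k+1}` is a subgradient of `g` at a point of the form
`w - α_k z^{k+1}`, where `w = A x^{k+1} + α z^k` lies in the neighbourhood of `A(S)` on which `g` is
Lipschitz, so that convexity bounds it by the Lipschitz constant (`IsAdaptiveDPFS.norm_z_le`).
Hence the test `(α_k - α) ‖z^{k+1}‖ > ε` succeeds only finitely often, and `α_k` is eventually a
constant `αt > α` with `(αt - α) ‖z^{k+1}‖ ≤ ε` (`exists_updateCount_eq`).

From then on the merit function decreases by a multiple of the squared step length. The concave term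
`-g*` is the obstacle; it is controlled by combining the subgradient inequality for `g*` with the
monotonicity of `∂g*` between consecutive iterates (`dual_step_bound`,
`IsConstStepRun.meritSeq_decrease`). As `K(S)` lies in the interior of `dom f`, the function
`f* - ⟨K x, ·⟩` grows linearly, uniformly in `x ∈ S`, so the merit function is bounded below and the
`y^k` are bounded (`IsConstStepRun.exists_meritSeq_ge`).

Essential strict convexity of `g` makes `g*` differentiable wherever it is subdifferentiable
(`EssStrictlyConvex.conj_le_near`). This yields explicit Fréchet subgradients of the merit function
(`mem_frechetSubdiff_merit`), whose norm at the iterates is bounded by a multiple of the step length.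
The Kurdyka-Łojasiewicz argument (`summable_of_kurdyka_lojasiewicz`) then shows that the step lengths
are summable, so the sequence converges. Closedness of the graphs of the subdifferentials gives
`A x - (αt - α) z ∈ ∂g*(z)` at the limit, together with the other two conditions; since
`(αt - α) ‖z‖ ≤ ε`, the Lipschitz property of `g` turns this into the approximate inclusion
(`mem_epsSubdiff_conj_of_shift`).

Facts on conjugates that usually rest on a separation theorem are obtained here from the existence of
proximal points, which in finite dimension follows from compactness alone (`exists_isProx`); Minty's
argument then inverts the subdifferential (`mem_convSubdiff_of_conj`).
-/

namespace DPFS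

/-! ### Convex functions with extended real values -/

section ConvexAnalysis

theorem exists_real_of_mem_dom {H : Type*} {h : H → EReal} (hp : Proper h) {x : H} (hx : h x ≠ ⊤) :
    ∃ r : ℝ, h x = r :=
  ⟨(h x).toReal, (EReal.coe_toReal hx (hp.2 x)).symm⟩

variable {H : Type*} [NormedAddCommGroup H] [InnerProductSpace ℝ H]

theorem ConvexFun.le_combo {h : H → EReal} (hc : ConvexFun h) {x y : H} {s t a b : ℝ}
    (hx : h x ≤ s) (hy : h y ≤ t) (ha : 0 ≤ a) (hb : 0 ≤ b) (hab : a + b = 1) :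
    h (a • x + b • y) ≤ ((a * s + b * t : ℝ) : EReal) :=
  hc (x := (x, s)) hx (y := (y, t)) hy ha hb hab

theorem mem_convSubdiff_iff {h : H → EReal} {x v : H} :
    v ∈ convSubdiff h x ↔ ∃ r : ℝ, h x = r ∧ ∀ u, ((r + ⟪v, u - x⟫ : ℝ) : EReal) ≤ h u := by
  constructor
  · rintro ⟨h1, h2, h3⟩
    refine ⟨(h x).toReal, (EReal.coe_toReal h1 h2).symm, fun u => ?_⟩
    have := h3 u
    rwa [sub_zero, ← EReal.coe_toReal h1 h2, ← EReal.coe_add] at this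
  · rintro ⟨r, hr, h3⟩
    refine ⟨by simp [hr], by simp [hr], fun u => ?_⟩
    rw [hr, sub_zero, ← EReal.coe_add]
    exact h3 u

theorem convSubdiff_monotone {h : H → EReal} {x y v w : H} (hv : v ∈ convSubdiff h x)
    (hw : w ∈ convSubdiff h y) : 0 ≤ ⟪v - w, x - y⟫ := by
  obtain ⟨r, hr, h1⟩ := mem_convSubdiff_iff.1 hv
  obtain ⟨s, hs, h2⟩ := mem_convSubdiff_iff.1 hw
  have h3 := h1 y
  have h4 := h2 x
  rw [hs, EReal.coe_le_coe_iff] at h3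
  rw [hr, EReal.coe_le_coe_iff] at h4
  have h5 : ⟪v, y - x⟫ = - ⟪v, x - y⟫ := by rw [← inner_neg_right, neg_sub]
  rw [inner_sub_left]
  linarith

/-- A proper convex lower semicontinuous function on a finite-dimensional space is bounded below
by a cone-shaped function: on a unit ball it is bounded below by compactness, and convexity
propagates the bound outwards. -/
theorem exists_linear_growth_lower_bound [FiniteDimensional ℝ H] {h : H → EReal} (hp : Proper h)
    (hc : ConvexFun h) (hl : LowerSemicontinuous h) :
    ∃ (x₀ : H) (r₀ L : ℝ), h x₀ = r₀ ∧ 0 ≤ L ∧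
      ∀ u, ((r₀ - L - L * ‖u - x₀‖ : ℝ) : EReal) ≤ h u := by
  obtain ⟨x₀, hx₀⟩ := hp.1
  obtain ⟨r₀, hr₀⟩ := exists_real_of_mem_dom hp (ne_of_lt hx₀)
  obtain ⟨p, -, hmin⟩ := (hl.lowerSemicontinuousOn (Metric.closedBall x₀ 1)).exists_isMinOn
    ⟨x₀, Metric.mem_closedBall_self zero_le_one⟩ (isCompact_closedBall x₀ 1)
  rw [isMinOn_iff] at hmin
  have hpx : h p ≤ h x₀ := hmin _ (Metric.mem_closedBall_self zero_le_one)
  obtain ⟨m, hm⟩ := exists_real_of_mem_dom hp (ne_of_lt (hpx.trans_lt hx₀))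
  rw [hm, hr₀, EReal.coe_le_coe_iff] at hpx
  refine ⟨x₀, r₀, r₀ - m, hr₀, by linarith, fun u => ?_⟩
  by_cases hu : h u = ⊤
  · simp [hu]
  obtain ⟨t, ht⟩ := exists_real_of_mem_dom hp hu
  rw [ht, EReal.coe_le_coe_iff]
  rcases le_total ‖u - x₀‖ 1 with hd | hd
  · have := hmin u (by simpa [dist_eq_norm] using hd)
    rw [hm, ht, EReal.coe_le_coe_iff] at this
    nlinarith [norm_nonneg (u - x₀)]
  · set d := ‖u - x₀‖ with hddef
    have hd0 : 0 < d := by linarith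
    have h1 := hc.le_combo hr₀.le ht.le (a := 1 - d⁻¹) (b := d⁻¹)
      (by have := inv_le_one_of_one_le₀ hd; linarith) (by positivity) (by ring)
    have h2 : (1 - d⁻¹) • x₀ + d⁻¹ • u = x₀ + d⁻¹ • (u - x₀) := by module
    rw [h2] at h1
    have h3 := (hmin (x₀ + d⁻¹ • (u - x₀)) (by
      rw [mem_closedBall_iff_norm, add_sub_cancel_left, norm_smul, ← hddef, norm_inv,
        Real.norm_of_nonneg hd0.le, inv_mul_cancel₀ hd0.ne'])).trans h1
    rw [hm, EReal.coe_le_coe_iff] at h3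
    have h4 : d * m ≤ d * ((1 - d⁻¹) * r₀ + d⁻¹ * t) := mul_le_mul_of_nonneg_left h3 hd0.le
    have h5 : d * ((1 - d⁻¹) * r₀ + d⁻¹ * t) = (d - 1) * r₀ + t := by
      field_simp
    nlinarith

/-- Existence of the proximal point. -/
theorem exists_isProx [FiniteDimensional ℝ H] {h : H → EReal} (hp : Proper h)
    (hc : ConvexFun h) (hl : LowerSemicontinuous h) (w : H) : ∃ q, IsProx h 1 w q := by
  obtain ⟨x₀, r₀, L, hr₀, hL, hgrow⟩ := exists_linear_growth_lower_bound hp hc hl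
  set c := ‖x₀ - w‖ with hcdef
  have hc0 : 0 ≤ c := norm_nonneg _
  -- outside this ball the objective exceeds its value at `x₀`
  set R := 2 * (c + L) + 2 with hR
  set F : H → EReal := fun u => h u + ((1 / (2 * 1) * ‖u - w‖ ^ 2 : ℝ) : EReal) with hF
  have hFl : LowerSemicontinuous F := by
    refine LowerSemicontinuous.add' hl ?_ ?_
    · refine Continuous.lowerSemicontinuous ?_
      exact continuous_coe_real_ereal.comp (by fun_prop)
    · intro u
      exact EReal.continuousAt_add (Or.inr (EReal.coe_ne_bot _)) (Or.inr (EReal.coe_ne_top _))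
  have hx₀mem : x₀ ∈ Metric.closedBall x₀ R := Metric.mem_closedBall_self (by positivity)
  obtain ⟨q, -, hmin⟩ := (hFl.lowerSemicontinuousOn (Metric.closedBall x₀ R)).exists_isMinOn
    ⟨x₀, hx₀mem⟩ (isCompact_closedBall x₀ R)
  rw [isMinOn_iff] at hmin
  refine ⟨q, fun u => ?_⟩
  by_cases hu : u ∈ Metric.closedBall x₀ R
  · exact hmin u hu
  · refine (hmin x₀ hx₀mem).trans ?_
    have h1 := add_le_add_left (hgrow u) ((1 / (2 * 1) * ‖u - w‖ ^ 2 : ℝ) : EReal)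
    refine le_trans ?_ h1
    simp only [hF]
    rw [hr₀, ← EReal.coe_add, ← EReal.coe_add, EReal.coe_le_coe_iff, ← hcdef]
    rw [mem_closedBall_iff_norm, not_le] at hu
    set d := ‖u - x₀‖
    have h2 : d - c ≤ ‖u - w‖ := by
      have : d ≤ ‖u - w‖ + ‖w - x₀‖ := norm_sub_le_norm_sub_add_norm_sub u w x₀
      rw [norm_sub_rev w x₀] at this
      linarith
    have h3 : (d - c) ^ 2 ≤ ‖u - w‖ ^ 2 := pow_le_pow_left₀ (by linarith) h2 2
    nlinarith

/-- Fermat's rule for the proximal problem. -/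
theorem IsProx.mem_convSubdiff {h : H → EReal} (hp : Proper h) (hc : ConvexFun h) {t : ℝ}
    (ht : 0 < t) {w q : H} (hq : IsProx h t w q) : (1 / t) • (w - q) ∈ convSubdiff h q := by
  have hqt : h q ≠ ⊤ := by
    intro hq'
    obtain ⟨x₀, hx₀⟩ := hp.1
    obtain ⟨r₀, hr₀⟩ := exists_real_of_mem_dom hp (ne_of_lt hx₀)
    have := hq x₀
    rw [hq', hr₀, ← EReal.coe_add, EReal.top_add_coe] at this
    exact absurd this (by simp [-EReal.coe_add])
  obtain ⟨r, hr⟩ := exists_real_of_mem_dom hp hqt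
  refine mem_convSubdiff_iff.2 ⟨r, hr, fun u => ?_⟩
  by_cases hu : h u = ⊤
  · simp [hu]
  obtain ⟨s, hs⟩ := exists_real_of_mem_dom hp hu
  rw [hs, EReal.coe_le_coe_iff]
  have key : ∀ τ : ℝ, 0 < τ → τ ≤ 1 →
      0 ≤ (s - r - ⟪(1 / t) • (w - q), u - q⟫) + τ * (1 / (2 * t) * ‖u - q‖ ^ 2) := by
    intro τ h0 h1
    have h2 := hc.le_combo hr.le hs.le (a := 1 - τ) (b := τ) (by linarith) h0.le (by ring)
    have h3 := (hq ((1 - τ) • q + τ • u)).trans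
      (add_le_add_left h2 _)
    rw [hr, ← EReal.coe_add, ← EReal.coe_add, EReal.coe_le_coe_iff] at h3
    have h4 : (1 - τ) • q + τ • u - w = (q - w) + τ • (u - q) := by module
    rw [h4, norm_add_sq_real, inner_smul_right, norm_smul, Real.norm_of_nonneg h0.le] at h3
    have h5 : ⟪(1 / t) • (w - q), u - q⟫ = - (1 / t * ⟪q - w, u - q⟫) := by
      rw [inner_smul_left, ← neg_sub q w, inner_neg_left]; simp
    rw [h5]
    have h6 : 0 ≤ τ * ((s - r + 1 / t * ⟪q - w, u - q⟫) + τ * (1 / (2 * t) * ‖u - q‖ ^ 2)) := by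
      have : 1 / t = 2 * (1 / (2 * t)) := by field_simp
      rw [this]
      nlinarith
    have := nonneg_of_mul_nonneg_right h6 h0
    linarith
  have hlim : Tendsto (fun τ : ℝ => (s - r - ⟪(1 / t) • (w - q), u - q⟫)
      + τ * (1 / (2 * t) * ‖u - q‖ ^ 2)) (𝓝[>] 0)
      (𝓝 ((s - r - ⟪(1 / t) • (w - q), u - q⟫) + 0 * (1 / (2 * t) * ‖u - q‖ ^ 2))) := by
    refine Tendsto.mono_left ?_ nhdsWithin_le_nhds
    exact Continuous.tendsto (by fun_prop) 0
  have := ge_of_tendsto hlim (by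
    filter_upwards [Ioc_mem_nhdsGT (zero_lt_one' ℝ)] with τ hτ using key τ hτ.1 hτ.2)
  linarith

/-! ### Conjugates -/

theorem conj_ge {h : H → EReal} {x : H} {r : ℝ} (hx : h x ≤ r) (v : H) :
    ((⟪v, x⟫ - r : ℝ) : EReal) ≤ conj h v := by
  refine le_trans ?_ (le_iSup (fun x : H => ((⟪v, x⟫ : ℝ) : EReal) - h x) x)
  rw [EReal.coe_sub]
  exact EReal.sub_le_sub le_rfl hx

theorem conj_le {h : H → EReal} {v : H} {c : ℝ}
    (hh : ∀ u, ((⟪v, u⟫ - c : ℝ) : EReal) ≤ h u) : conj h v ≤ c := by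
  refine iSup_le fun u => ?_
  refine EReal.sub_le_of_le_add ?_
  have h1 := add_le_add_right (hh u) (c : EReal)
  rwa [← EReal.coe_add, add_sub_cancel] at h1

/-- The Fenchel-Young equality. -/
theorem conj_eq_of_mem_convSubdiff {h : H → EReal} {x v : H} {r : ℝ} (hr : h x = r)
    (hv : v ∈ convSubdiff h x) : conj h v = ((⟪v, x⟫ - r : ℝ) : EReal) := by
  obtain ⟨r', hr', h1⟩ := mem_convSubdiff_iff.1 hv
  obtain rfl : r = r' := by rw [hr] at hr'; exact_mod_cast hr'
  refine le_antisymm (conj_le fun u => ?_) (conj_ge hr.le v)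
  convert h1 u using 2
  rw [inner_sub_right]; ring

theorem mem_convSubdiff_conj {h : H → EReal} {x v : H} (hv : v ∈ convSubdiff h x) :
    x ∈ convSubdiff (conj h) v := by
  obtain ⟨r, hr, h1⟩ := mem_convSubdiff_iff.1 hv
  refine mem_convSubdiff_iff.2 ⟨_, conj_eq_of_mem_convSubdiff hr hv, fun u => ?_⟩
  convert conj_ge hr.le u using 2
  rw [inner_sub_right, real_inner_comm u x, real_inner_comm v x]; ring

theorem proper_conj [FiniteDimensional ℝ H] {h : H → EReal} (hp : Proper h)
    (hc : ConvexFun h) (hl : LowerSemicontinuous h) : Proper (conj h) := by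
  constructor
  · obtain ⟨q, hq⟩ := exists_isProx hp hc hl 0
    have h1 := hq.mem_convSubdiff hp hc one_pos
    obtain ⟨r, hr, -⟩ := mem_convSubdiff_iff.1 h1
    exact ⟨_, show conj h _ < ⊤ by rw [conj_eq_of_mem_convSubdiff hr h1]; exact EReal.coe_lt_top _⟩
  · intro v hv
    obtain ⟨x₀, hx₀⟩ := hp.1
    obtain ⟨r₀, hr₀⟩ := exists_real_of_mem_dom hp (ne_of_lt hx₀)
    have := conj_ge hr₀.le v
    rw [hv] at this
    exact absurd this (by simp [-EReal.coe_sub])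

theorem convexFun_conj {h : H → EReal} (hp : Proper h) : ConvexFun (conj h) := by
  rintro ⟨v, s⟩ hv ⟨w, t⟩ hw a b ha hb hab
  simp only [mem_ofPred_eq] at hv hw
  change conj h (a • v + b • w) ≤ ((a * s + b * t : ℝ) : EReal)
  refine conj_le fun u => ?_
  by_cases hu : h u = ⊤
  · simp [hu]
  obtain ⟨r, hr⟩ := exists_real_of_mem_dom hp hu
  have h1 := (conj_ge hr.le v).trans hv
  have h2 := (conj_ge hr.le w).trans hw
  rw [EReal.coe_le_coe_iff] at h1 h2
  rw [hr, EReal.coe_le_coe_iff, inner_add_left, inner_smul_left, inner_smul_left]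
  simp only [conj_trivial]
  obtain rfl : b = 1 - a := by linarith
  nlinarith

theorem lowerSemicontinuous_conj {h : H → EReal} (hp : Proper h) :
    LowerSemicontinuous (conj h) := by
  refine lowerSemicontinuous_iSup fun x => Continuous.lowerSemicontinuous ?_
  by_cases hx : h x = ⊤
  · simp only [hx, EReal.sub_top]; exact continuous_const
  obtain ⟨r, hr⟩ := exists_real_of_mem_dom hp hx
  simp only [hr, ← EReal.coe_sub]
  exact continuous_coe_real_ereal.comp (by fun_prop)

/-- Inversion of the subdifferential. By Minty's argument the proximal point `q` of `h` at
`x + v` satisfies `x + v - q ∈ ∂h(q)`, and monotonicity of `∂h*` forces `q = x`. -/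
theorem mem_convSubdiff_of_conj [FiniteDimensional ℝ H] {h : H → EReal} (hp : Proper h)
    (hc : ConvexFun h) (hl : LowerSemicontinuous h) {x v : H}
    (hx : x ∈ convSubdiff (conj h) v) : v ∈ convSubdiff h x := by
  obtain ⟨q, hq⟩ := exists_isProx hp hc hl (x + v)
  have h1 := hq.mem_convSubdiff hp hc one_pos
  rw [div_one, one_smul] at h1
  have h2 := convSubdiff_monotone hx (mem_convSubdiff_conj h1)
  have h3 : v - (x + v - q) = -(x - q) := by abel
  rw [h3, inner_neg_right, real_inner_self_eq_norm_sq] at h2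
  have h4 : ‖x - q‖ = 0 := by nlinarith [norm_nonneg (x - q)]
  obtain rfl : x = q := sub_eq_zero.1 (norm_eq_zero.1 h4)
  simpa using h1

/-- The graph of the subdifferential is closed, and the function converges along sequences in
the graph. -/
theorem tendsto_of_mem_convSubdiff {h : H → EReal} (hp : Proper h) (hl : LowerSemicontinuous h)
    {x v : ℕ → H} {r : ℕ → ℝ} {xb vb : H} (hx : Tendsto x atTop (𝓝 xb))
    (hv : Tendsto v atTop (𝓝 vb)) (hr : ∀ k, h (x k) = r k)
    (hm : ∀ k, v k ∈ convSubdiff h (x k)) :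
    vb ∈ convSubdiff h xb ∧ ∃ rb : ℝ, h xb = rb ∧ Tendsto r atTop (𝓝 rb) := by
  have key : ∀ k u, ((r k + ⟪v k, u - x k⟫ : ℝ) : EReal) ≤ h u := by
    intro k u
    obtain ⟨r', hr', h1⟩ := mem_convSubdiff_iff.1 (hm k)
    obtain rfl : r k = r' := by rw [hr k] at hr'; exact_mod_cast hr'
    exact h1 u
  have hin : ∀ u, Tendsto (fun k => ⟪v k, u - x k⟫) atTop (𝓝 ⟪vb, u - xb⟫) := fun u =>
    hv.inner (tendsto_const_nhds.sub hx)
  -- lower semicontinuity bounds `h xb` by any upper limit of the values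
  have hlow : ∀ c : ℝ, (c : EReal) < h xb → ∀ᶠ k in atTop, c < r k := by
    intro c hcx
    filter_upwards [hx.eventually (hl xb c hcx)] with k hk
    rw [hr k] at hk
    exact_mod_cast hk
  have hub : ∀ u : H, ∀ t : ℝ, h u = t → h xb ≤ ((t - ⟪vb, u - xb⟫ : ℝ) : EReal) := by
    intro u t ht
    by_contra hcon
    rw [not_le] at hcon
    obtain ⟨c, hc1, hc2⟩ := EReal.exists_between_coe_real hcon
    rw [EReal.coe_lt_coe_iff] at hc1
    have h1 : ∀ᶠ k in atTop, c ≤ t - ⟪v k, u - x k⟫ := by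
      filter_upwards [hlow c hc2] with k hk
      have := key k u
      rw [ht, EReal.coe_le_coe_iff] at this
      linarith
    have := ge_of_tendsto (tendsto_const_nhds.sub (hin u)) h1
    linarith
  obtain ⟨u₀, hu₀⟩ := hp.1
  obtain ⟨t₀, ht₀⟩ := exists_real_of_mem_dom hp (ne_of_lt hu₀)
  obtain ⟨rb, hrb⟩ := exists_real_of_mem_dom hp
    (ne_of_lt ((hub u₀ t₀ ht₀).trans_lt (EReal.coe_lt_top _)))
  refine ⟨mem_convSubdiff_iff.2 ⟨rb, hrb, fun u => ?_⟩, rb, hrb, ?_⟩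
  · by_cases hu : h u = ⊤
    · simp [hu]
    obtain ⟨t, ht⟩ := exists_real_of_mem_dom hp hu
    have := hub u t ht
    rw [hrb, EReal.coe_le_coe_iff] at this
    rw [ht, EReal.coe_le_coe_iff]
    linarith
  · rw [tendsto_order]
    refine ⟨fun c hc => hlow c (by rw [hrb]; exact_mod_cast hc), fun c hc => ?_⟩
    have h1 : Tendsto (fun k => rb - ⟪v k, xb - x k⟫) atTop (𝓝 rb) := by
      simpa using (tendsto_const_nhds (x := rb)).sub (hin xb)
    filter_upwards [h1.eventually_lt_const hc] with k hk
    have := key k xb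
    rw [hrb, EReal.coe_le_coe_iff] at this
    linarith

/-- A subgradient of an essentially strictly convex function exposes a single point. -/
theorem EssStrictlyConvex.lt_of_mem_convSubdiff {g : H → EReal} (hg : EssStrictlyConvex g)
    (hc : ConvexFun g) {q z v : H} {r : ℝ} (hr : g q = r) (hz : z ∈ convSubdiff g q)
    (hv : v ≠ q) : ((r + ⟪z, v - q⟫ : ℝ) : EReal) < g v := by
  obtain ⟨r', hr', h1⟩ := mem_convSubdiff_iff.1 hz
  obtain rfl : r = r' := by rw [hr] at hr'; exact_mod_cast hr'
  refine lt_of_le_of_ne (h1 v) fun heq => ?_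
  -- otherwise `g` is affine on the segment from `q` to `v`, and `z` is a subgradient there
  have hseg : ∀ c ∈ segment ℝ q v, g c = ((r + ⟪z, c - q⟫ : ℝ) : EReal) := by
    rintro c ⟨a, b, ha, hb, hab, rfl⟩
    refine le_antisymm ?_ (h1 _)
    refine (hc.le_combo hr.le heq.ge ha hb hab).trans (le_of_eq ?_)
    congr 1
    obtain rfl : a = 1 - b := by linarith
    have : (1 - b) • q + b • v - q = b • (v - q) := by module
    rw [this, inner_smul_right]; ring
  have hsub : segment ℝ q v ⊆ {x | (convSubdiff g x).Nonempty} := by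
    intro c hcs
    refine ⟨z, mem_convSubdiff_iff.2 ⟨_, hseg c hcs, fun u => ?_⟩⟩
    convert h1 u using 2
    rw [add_assoc, ← inner_add_right]; congr 2; abel
  have h2 := hg.2 _ ⟨q, left_mem_segment ℝ q v⟩ (convex_segment q v) hsub q
    (left_mem_segment ℝ q v) v (right_mem_segment ℝ q v) hv.symm (1 / 2) (1 / 2)
    (by norm_num) (by norm_num) (by norm_num)
  have h3 : (1 / 2 : ℝ) • q + (1 / 2 : ℝ) • v ∈ segment ℝ q v :=
    ⟨1 / 2, 1 / 2, by norm_num, by norm_num, by norm_num, rfl⟩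
  rw [hseg _ h3, hr, ← heq, ← EReal.coe_mul, ← EReal.coe_mul, ← EReal.coe_add,
    EReal.coe_lt_coe_iff] at h2
  have h4 : (1 / 2 : ℝ) • q + (1 / 2 : ℝ) • v - q = (1 / 2 : ℝ) • (v - q) := by module
  rw [h4, inner_smul_right] at h2
  linarith

/-- The conjugate of an essentially strictly convex function is differentiable wherever it is
subdifferentiable. Only the upper estimate is stated, as the lower one is the subgradient
inequality. The function `g - ⟨z, ·⟩` has the unique minimizer `q`, so it grows at least linearly
away from any ball about `q`, and small perturbations of `z` do not move the supremum defining the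
conjugate out of that ball. -/
theorem EssStrictlyConvex.conj_le_near [FiniteDimensional ℝ H] {g : H → EReal}
    (hg : EssStrictlyConvex g) (hc : ConvexFun g) (hl : LowerSemicontinuous g) {q z : H} {c : ℝ}
    (hz : z ∈ convSubdiff g q) (hcz : conj g z = c) {e : ℝ} (he : 0 < e) :
    ∃ δ > 0, ∀ d : H, ‖d‖ ≤ δ → conj g (z + d) ≤ ((c + ⟪q, d⟫ + e * ‖d‖ : ℝ) : EReal) := by
  obtain ⟨r, hr, h1⟩ := mem_convSubdiff_iff.1 hz
  have hcr : c = ⟪z, q⟫ - r := by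
    have := conj_eq_of_mem_convSubdiff hr hz
    rw [hcz] at this; exact_mod_cast this
  -- a positive gap on the sphere of radius `e`
  obtain ⟨m, hm0, hm⟩ : ∃ m : ℝ, 0 < m ∧ ∀ v, ‖v - q‖ = e →
      ((r + ⟪z, v - q⟫ + m : ℝ) : EReal) ≤ g v := by
    rcases (Metric.sphere q e).eq_empty_or_nonempty with hemp | hne
    · refine ⟨1, one_pos, fun v hv => ?_⟩
      have : v ∈ Metric.sphere q e := by simpa [dist_eq_norm] using hv
      simp [hemp] at this
    set G : H → EReal := fun v => g v + ((-(r + ⟪z, v - q⟫) : ℝ) : EReal) with hG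
    have hGl : LowerSemicontinuous G := by
      refine LowerSemicontinuous.add' hl ?_ ?_
      · refine Continuous.lowerSemicontinuous ?_
        exact continuous_coe_real_ereal.comp (by fun_prop)
      · intro u
        exact EReal.continuousAt_add (Or.inr (EReal.coe_ne_bot _)) (Or.inr (EReal.coe_ne_top _))
    obtain ⟨p, hp, hmin⟩ := (hGl.lowerSemicontinuousOn (Metric.sphere q e)).exists_isMinOn
      hne (isCompact_sphere q e)
    rw [isMinOn_iff] at hmin
    have hpq : p ≠ q := Metric.ne_of_mem_sphere hp he.ne'
    have hpos : (0 : EReal) < G p := by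
      have := EReal.add_lt_add_right_coe (hg.lt_of_mem_convSubdiff hc hr hz hpq)
        (-(r + ⟪z, p - q⟫))
      rwa [← EReal.coe_add, add_neg_cancel, EReal.coe_zero] at this
    obtain ⟨m, hm1, hm2⟩ := EReal.exists_between_coe_real hpos
    refine ⟨m, by exact_mod_cast hm1, fun v hv => ?_⟩
    have h2 := hm2.le.trans (hmin v (by simpa [dist_eq_norm] using hv))
    have h3 := add_le_add_left h2 ((r + ⟪z, v - q⟫ : ℝ) : EReal)
    simp only [hG] at h3
    rw [add_assoc, ← EReal.coe_add, ← EReal.coe_add, neg_add_cancel, EReal.coe_zero,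
      add_zero] at h3
    rwa [add_comm]
  refine ⟨m / e, by positivity, fun d hd => conj_le fun u => ?_⟩
  by_cases hu : g u = ⊤
  · simp [hu]
  obtain ⟨t, ht⟩ := exists_real_of_mem_dom hg.1 hu
  rw [ht, EReal.coe_le_coe_iff]
  have h2 := h1 u
  rw [ht, EReal.coe_le_coe_iff] at h2
  have h3 : ⟪z + d, u⟫ = ⟪z, u - q⟫ + ⟪z, q⟫ + ⟪d, u - q⟫ + ⟪q, d⟫ := by
    rw [inner_add_left, inner_sub_right, inner_sub_right, real_inner_comm d q]; ring
  have h4 : ⟪d, u - q⟫ ≤ ‖d‖ * ‖u - q‖ := real_inner_le_norm _ _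
  rw [h3, hcr]
  rcases le_total ‖u - q‖ e with hue | hue
  · have : ‖d‖ * ‖u - q‖ ≤ ‖d‖ * e := mul_le_mul_of_nonneg_left hue (norm_nonneg d)
    linarith
  · set n := ‖u - q‖ with hn
    have hn0 : 0 < n := by linarith
    have hen : e / n ≤ 1 := (div_le_one hn0).2 hue
    have h5 := hc.le_combo hr.le ht.le (a := 1 - e / n) (b := e / n)
      (by linarith) (by positivity) (by ring)
    have h6 : (1 - e / n) • q + (e / n) • u = q + (e / n) • (u - q) := by module
    rw [h6] at h5
    have h7 := (hm (q + (e / n) • (u - q)) (by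
      rw [add_sub_cancel_left, norm_smul, ← hn, Real.norm_of_nonneg (by positivity),
        div_mul_cancel₀ _ hn0.ne'])).trans h5
    rw [EReal.coe_le_coe_iff, add_sub_cancel_left, inner_smul_right] at h7
    have h8 : m ≤ e / n * (t - r - ⟪z, u - q⟫) := by linarith
    have h9 : m / e * n ≤ t - r - ⟪z, u - q⟫ := by
      have h10 := mul_le_mul_of_nonneg_left h8 (show 0 ≤ n / e by positivity)
      have e1 : n / e * (e / n * (t - r - ⟪z, u - q⟫)) = t - r - ⟪z, u - q⟫ := by
        field_simp
      have e2 : n / e * m = m / e * n := by ring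
      linarith
    have h11 : ‖d‖ * n ≤ m / e * n := mul_le_mul_of_nonneg_right hd hn0.le
    have h12 : 0 ≤ e * ‖d‖ := by positivity
    linarith

end ConvexAnalysis

/-! ### Smooth functions -/

section Smooth

variable {H : Type*} [NormedAddCommGroup H] [InnerProductSpace ℝ H] [CompleteSpace H]

theorem le_quadratic_of_hasGradientAt {φ : H → ℝ} {G : H → H} {ℓ : ℝ≥0}
    (hφ : ∀ x, HasGradientAt φ (G x) x) (hG : LipschitzWith ℓ G) (x y : H) :
    φ y ≤ φ x + ⟪G x, y - x⟫ + ℓ / 2 * ‖y - x‖ ^ 2 := by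
  set d := y - x with hd
  have hderiv : ∀ t : ℝ, HasDerivAt
      (fun t : ℝ => φ (x + t • d) - t * ⟪G x, d⟫ - ℓ / 2 * ‖d‖ ^ 2 * t ^ 2)
      (⟪G (x + t • d), d⟫ - 1 * ⟪G x, d⟫ - ℓ / 2 * ‖d‖ ^ 2 * (2 * t)) t := by
    intro t
    have h1 : HasDerivAt (fun t : ℝ => x + t • d) d t := by
      simpa using ((hasDerivAt_id t).smul_const d).const_add x
    have h2 := (hφ (x + t • d)).hasFDerivAt.comp_hasDerivAt t h1
    have h3 : HasDerivAt (fun t : ℝ => φ (x + t • d)) ⟪G (x + t • d), d⟫ t := by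
      simpa [Function.comp_def] using h2
    have h4 := ((hasDerivAt_id t).mul_const ⟪G x, d⟫)
    have h5 : HasDerivAt (fun t : ℝ => ℓ / 2 * ‖d‖ ^ 2 * t ^ 2)
        (ℓ / 2 * ‖d‖ ^ 2 * (2 * t)) t := by
      simpa using (hasDerivAt_pow 2 t).const_mul ((ℓ : ℝ) / 2 * ‖d‖ ^ 2)
    exact (h3.sub h4).sub h5
  have hanti := antitoneOn_of_deriv_nonpos (convex_Icc (0 : ℝ) 1)
    (fun t _ => (hderiv t).continuousAt.continuousWithinAt)
    (fun t _ => (hderiv t).differentiableAt.differentiableWithinAt) (fun t ht => by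
      rw [interior_Icc] at ht
      rw [(hderiv t).deriv, one_mul, ← inner_sub_left]
      have h6 : ⟪G (x + t • d) - G x, d⟫ ≤ ‖G (x + t • d) - G x‖ * ‖d‖ := real_inner_le_norm _ _
      have h7 := hG.norm_sub_le (x + t • d) x
      rw [add_sub_cancel_left, norm_smul, Real.norm_of_nonneg ht.1.le] at h7
      have h8 := mul_le_mul_of_nonneg_right h7 (norm_nonneg d)
      nlinarith)
  have h9 := hanti (left_mem_Icc.2 zero_le_one) (right_mem_Icc.2 zero_le_one) zero_le_one
  have h10 : x + d = y := by simp [hd]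
  simp only [one_smul, zero_smul, h10, add_zero] at h9
  linarith

theorem le_quadratic_of_lipschitz_gradient {φ : H → ℝ} (hφ : Differentiable ℝ φ) {ℓ : ℝ≥0}
    (hℓ : LipschitzWith ℓ (gradient φ)) (x y : H) :
    φ y ≤ φ x + ⟪gradient φ x, y - x⟫ + ℓ / 2 * ‖y - x‖ ^ 2 :=
  le_quadratic_of_hasGradientAt (fun x => (hφ x).hasGradientAt) hℓ x y

theorem quadratic_le_of_lipschitz_gradient {φ : H → ℝ} (hφ : Differentiable ℝ φ) {ℓ : ℝ≥0}
    (hℓ : LipschitzWith ℓ (gradient φ)) (x y : H) :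
    φ x + ⟪gradient φ x, y - x⟫ - ℓ / 2 * ‖y - x‖ ^ 2 ≤ φ y := by
  have h1 := le_quadratic_of_hasGradientAt (φ := fun x => -φ x) (G := fun x => -gradient φ x)
    (ℓ := ℓ) (fun x => by
      rw [hasGradientAt_iff_hasFDerivAt, map_neg]
      exact (hφ x).hasGradientAt.hasFDerivAt.neg)
    (by
      refine LipschitzWith.of_dist_le_mul fun a b => ?_
      rw [dist_neg_neg]
      exact hℓ.dist_le_mul a b) x y
  rw [inner_neg_left] at h1
  linarith

end Smooth

/-! ### Subgradients of the merit function -/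

theorem mem_frechetSubdiff_of_eventually {H : Type*} [NormedAddCommGroup H]
    [InnerProductSpace ℝ H] {h : H → EReal} {x v : H} {r : ℝ} (hr : h x = r)
    (hh : ∀ e : ℝ, 0 < e →
      ∀ᶠ u in 𝓝 x, ((r + ⟪v, u - x⟫ - e * ‖u - x‖ : ℝ) : EReal) ≤ h u) :
    v ∈ frechetSubdiff h x := by
  refine ⟨by simp [hr], by simp [hr], ?_⟩
  by_contra hcon
  rw [not_le] at hcon
  obtain ⟨c, hc1, hc2⟩ := EReal.exists_between_coe_real hcon
  refine absurd (le_liminf_of_le (by isBoundedDefault) ?_) (not_le.2 hc1)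
  have hc0 : c < 0 := by exact_mod_cast hc2
  filter_upwards [nhdsWithin_le_nhds (hh (-c) (by linarith)), self_mem_nhdsWithin] with u hu hux
  have hn : 0 < ‖u - x‖ := norm_pos_iff.2 (sub_ne_zero.2 hux)
  rw [EReal.le_div_iff_mul_le (by exact_mod_cast hn) (EReal.coe_ne_top _), hr,
    EReal.le_sub_iff_add_le (Or.inl (EReal.coe_ne_bot _)) (Or.inl (EReal.coe_ne_top _)),
    EReal.le_sub_iff_add_le (Or.inl (EReal.coe_ne_bot _)) (Or.inl (EReal.coe_ne_top _)),
    ← EReal.coe_mul, ← EReal.coe_add, ← EReal.coe_add]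
  convert hu using 2
  ring

theorem frechetSubdiff_subset_limSubdiff {H : Type*} [NormedAddCommGroup H]
    [InnerProductSpace ℝ H] (h : H → EReal) (x : H) : frechetSubdiff h x ⊆ limSubdiff h x :=
  fun v hv => ⟨hv.1, hv.2.1, fun _ => x, fun _ => v, tendsto_const_nhds, tendsto_const_nhds,
    tendsto_const_nhds, fun _ => hv⟩

section Merit

variable {n p s : ℕ}

/-- The point of `ℝⁿ × ℝᵖ × ℝˢ × ℝˢ` with the given components. -/
abbrev quad (x : E n) (y : E p) (z u : E s) : Quad n p s :=
  WithLp.toLp 2 (x, WithLp.toLp 2 (y, WithLp.toLp 2 (z, u)))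

theorem inner_quad (x : E n) (y : E p) (z u : E s) (w : Quad n p s) :
    ⟪quad x y z u, w⟫ =
      ⟪x, w.fst⟫ + (⟪y, w.snd.fst⟫ + (⟪z, w.snd.snd.fst⟫ + ⟪u, w.snd.snd.snd⟫)) := by
  simp only [WithLp.prod_inner_apply]
  rfl

theorem norm_quad_le (x : E n) (y : E p) (z u : E s) :
    ‖quad x y z u‖ ≤ ‖x‖ + ‖y‖ + ‖z‖ + ‖u‖ := by
  refine le_of_sq_le_sq ?_ (by positivity)
  simp only [WithLp.prod_norm_sq_eq_of_L2]
  change ‖x‖ ^ 2 + (‖y‖ ^ 2 + (‖z‖ ^ 2 + ‖u‖ ^ 2)) ≤ _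
  have h1 := norm_nonneg x
  have h2 := norm_nonneg y
  have h3 := norm_nonneg z
  have h4 := norm_nonneg u
  nlinarith [mul_nonneg h1 h2, mul_nonneg h1 h3, mul_nonneg h1 h4, mul_nonneg h2 h3,
    mul_nonneg h2 h4, mul_nonneg h3 h4]

/-- The merit function at a point where it is finite, given the values `cg` and `cf` of the two
conjugates. -/
noncomputable def meritReal (φ : E n → ℝ) (A : E n →L[ℝ] E s) (K : E n →L[ℝ] E p) (α αt : ℝ)
    (x : E n) (y : E p) (z u : E s) (cg cf : ℝ) : ℝ :=
  ⟪z, A x⟫ - cg + φ x - ⟪K x, y⟫ + cf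
    + (α / 2 * (1 + 4 * α / (αt - α)) * ‖z - u‖ ^ 2 - 1 / 2 * (αt - α) * ‖z‖ ^ 2)

variable {S : Set (E n)} {g : E s → EReal} {φ : E n → ℝ} {f : E p → EReal}
    {A : E n →L[ℝ] E s} {K : E n →L[ℝ] E p} {α αt : ℝ}

theorem merit_eq {w : Quad n p s} {cg cf : ℝ} (hx : w.fst ∈ S)
    (hg : conj g w.snd.snd.fst = cg) (hf : conj f w.snd.fst = cf) :
    merit S g φ f A K α αt w =
      (meritReal φ A K α αt w.fst w.snd.fst w.snd.snd.fst w.snd.snd.snd cg cf : ℝ) := by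
  rw [merit, Psi, meritReal, hg, hf, indicatorFun, if_pos hx, add_zero]
  norm_cast

theorem merit_eq_top {w : Quad n p s} {cg : ℝ} (hf : ∀ y, conj f y ≠ ⊥)
    (hg : conj g w.snd.snd.fst = cg) (h : w.fst ∉ S ∨ conj f w.snd.fst = ⊤) :
    merit S g φ f A K α αt w = ⊤ := by
  rw [merit, Psi, hg, ← EReal.coe_sub, ← EReal.coe_add]
  by_cases hx : w.fst ∈ S
  · rw [indicatorFun, if_pos hx, add_zero, ← EReal.coe_sub, h.resolve_left (not_not_intro hx),
      EReal.coe_add_top, EReal.top_add_coe]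
  · rw [indicatorFun, if_neg hx, EReal.coe_add_top, EReal.top_sub_coe,
      EReal.top_add_of_ne_bot (hf _), EReal.top_add_coe]

theorem mem_normalCone_iff {x ν : E n} (hx : x ∈ S) :
    ν ∈ normalCone S x ↔ ∀ c ∈ S, ⟪ν, c - x⟫ ≤ 0 := by
  rw [normalCone, mem_convSubdiff_iff]
  constructor
  · rintro ⟨r, hr, h1⟩ c hc
    have h2 := h1 c
    rw [indicatorFun, if_pos hx] at hr
    rw [indicatorFun, if_pos hc] at h2
    obtain rfl : 0 = r := by exact_mod_cast hr
    rw [zero_add] at h2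
    exact_mod_cast h2
  · intro h
    refine ⟨0, by rw [indicatorFun, if_pos hx]; rfl, fun u => ?_⟩
    by_cases hu : u ∈ S
    · rw [indicatorFun, if_pos hu, zero_add]
      exact_mod_cast h u hu
    · rw [indicatorFun, if_neg hu]; exact le_top

/-- The second-order lower estimate of the merit function on which the next theorem rests. -/
theorem meritReal_add_ge (hφ : Differentiable ℝ φ) {ℓφ : ℝ≥0}
    (hℓφ : LipschitzWith ℓφ (gradient φ)) (hα : 0 < α) (hαt : α < αt)
    {x dx ν : E n} {y dy v : E p} {z dz u du q : E s} {cg cg' cf cf' N e : ℝ}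
    (nx : ‖dx‖ ≤ N) (ny : ‖dy‖ ≤ N) (nz : ‖dz‖ ≤ N) (he : 0 ≤ e)
    (hg : cg' ≤ cg + ⟪q, dz⟫ + e * ‖dz‖) (hf : cf + ⟪v, dy⟫ ≤ cf') (hν : ⟪ν, dx⟫ ≤ 0) :
    meritReal φ A K α αt x y z u cg cf
      + (⟪gradient φ x + ContinuousLinearMap.adjoint A z - ContinuousLinearMap.adjoint K y + ν, dx⟫
        + (⟪v - K x, dy⟫
        + (⟪A x - q + (2 * (α / 2 * (1 + 4 * α / (αt - α)))) • (z - u) - (αt - α) • z, dz⟫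
        + ⟪-((2 * (α / 2 * (1 + 4 * α / (αt - α)))) • (z - u)), du⟫)))
      - ((‖A‖ + ‖K‖ + ℓφ / 2 + (αt - α) / 2) * N ^ 2 + e * N)
    ≤ meritReal φ A K α αt (x + dx) (y + dy) (z + dz) (u + du) cg' cf' := by
  have hθ : 0 < αt - α := sub_pos.2 hαt
  rw [meritReal, meritReal]
  have hC0 : 0 ≤ α / 2 * (1 + 4 * α / (αt - α)) := by positivity
  generalize α / 2 * (1 + 4 * α / (αt - α)) = C at hC0 ⊢
  generalize αt - α = θ at hθ ⊢
  have nn : 0 ≤ N := (norm_nonneg dx).trans nx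
  have i3 := quadratic_le_of_lipschitz_gradient hφ hℓφ x (x + dx)
  rw [add_sub_cancel_left] at i3
  have r1 : ⟪z + dz, A (x + dx)⟫ = ⟪z, A x⟫ + ⟪ContinuousLinearMap.adjoint A z, dx⟫
      + ⟪A x, dz⟫ + ⟪dz, A dx⟫ := by
    rw [map_add, inner_add_left, inner_add_right, inner_add_right,
      ContinuousLinearMap.adjoint_inner_left, real_inner_comm dz (A x)]
    ring
  have r2 : ⟪K (x + dx), y + dy⟫ = ⟪K x, y⟫ + ⟪ContinuousLinearMap.adjoint K y, dx⟫
      + ⟪K x, dy⟫ + ⟪K dx, dy⟫ := by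
    rw [map_add, inner_add_left, inner_add_right, inner_add_right,
      ContinuousLinearMap.adjoint_inner_left, real_inner_comm (K dx) y]
    ring
  have r3 : ‖z + dz - (u + du)‖ ^ 2 = ‖z - u‖ ^ 2
      + 2 * (⟪z - u, dz⟫ - ⟪z - u, du⟫) + ‖dz - du‖ ^ 2 := by
    rw [add_sub_add_comm, norm_add_sq_real, inner_sub_right]
  have r4 : ‖z + dz‖ ^ 2 = ‖z‖ ^ 2 + 2 * ⟪z, dz⟫ + ‖dz‖ ^ 2 := norm_add_sq_real z dz
  rw [r1, r2, r3, r4]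
  simp only [inner_add_left _ _ dx, inner_sub_left _ _ dx, inner_add_left _ _ dz,
    inner_sub_left (_ + _) _ dz, inner_sub_left (A x) _ dz, inner_sub_left _ _ dy,
    inner_neg_left, inner_smul_left, conj_trivial]
  have b1 : -(‖A‖ * N ^ 2) ≤ ⟪dz, A dx⟫ := by
    have h1 := (abs_le.1 (abs_real_inner_le_norm dz (A dx))).1
    have h2 : ‖dz‖ * ‖A dx‖ ≤ N * (‖A‖ * N) :=
      mul_le_mul nz (A.le_opNorm_of_le nx) (norm_nonneg _) nn
    have h3 : N * (‖A‖ * N) = ‖A‖ * N ^ 2 := by ring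
    linarith
  have b2 : ⟪K dx, dy⟫ ≤ ‖K‖ * N ^ 2 := by
    have h1 := real_inner_le_norm (K dx) dy
    have h2 : ‖K dx‖ * ‖dy‖ ≤ (‖K‖ * N) * N :=
      mul_le_mul (K.le_opNorm_of_le nx) ny (norm_nonneg _) (by positivity)
    have h3 : (‖K‖ * N) * N = ‖K‖ * N ^ 2 := by ring
    linarith
  have b3 : (ℓφ : ℝ) / 2 * ‖dx‖ ^ 2 ≤ ℓφ / 2 * N ^ 2 := by gcongr
  have b4 : θ / 2 * ‖dz‖ ^ 2 ≤ θ / 2 * N ^ 2 := by gcongr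
  have b5 : 0 ≤ C * ‖dz - du‖ ^ 2 := by positivity
  have b6 : e * ‖dz‖ ≤ e * N := by gcongr
  linarith

/-- An explicit Fréchet subgradient of the merit function. The term `-g*` contributes `-q`, as `g*`
is differentiable at `z` with gradient `q`; the convex terms `ι_S` and `f*` contribute subgradients,
and the remaining terms are smooth. -/
theorem mem_frechetSubdiff_merit (hgess : EssStrictlyConvex g) (hgconv : ConvexFun g)
    (hglsc : LowerSemicontinuous g) (hf : Proper f) (hfconv : ConvexFun f)
    (hflsc : LowerSemicontinuous f) (hφ : Differentiable ℝ φ) {ℓφ : ℝ≥0}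
    (hℓφ : LipschitzWith ℓφ (gradient φ)) (hα : 0 < α) (hαt : α < αt)
    {x ν : E n} {y v : E p} {z u q : E s} (hx : x ∈ S) (hν : ν ∈ normalCone S x)
    (hv : v ∈ convSubdiff (conj f) y) (hq : q ∈ convSubdiff (conj g) z) :
    quad (gradient φ x + ContinuousLinearMap.adjoint A z - ContinuousLinearMap.adjoint K y + ν)
      (v - K x)
      (A x - q + (2 * (α / 2 * (1 + 4 * α / (αt - α)))) • (z - u) - (αt - α) • z)
      (-((2 * (α / 2 * (1 + 4 * α / (αt - α)))) • (z - u)))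
      ∈ frechetSubdiff (merit S g φ f A K α αt) (quad x y z u) := by
  obtain ⟨cg, hcg, -⟩ := mem_convSubdiff_iff.1 hq
  obtain ⟨cf, hcf, hv'⟩ := mem_convSubdiff_iff.1 hv
  have hfp := proper_conj hf hfconv hflsc
  have hgp := proper_conj hgess.1 hgconv hglsc
  have hθ : 0 < αt - α := sub_pos.2 hαt
  refine mem_frechetSubdiff_of_eventually
    (merit_eq (w := quad x y z u) hx hcg hcf) fun e he => ?_
  obtain ⟨δ, hδ, hnear⟩ := hgess.conj_le_near hgconv hglsc
    (mem_convSubdiff_of_conj hgess.1 hgconv hglsc hq) hcg (half_pos he)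
  set M := ‖A‖ + ‖K‖ + ℓφ / 2 + (αt - α) / 2 with hM
  have hM0 : 0 ≤ M := by positivity
  filter_upwards [Metric.closedBall_mem_nhds (quad x y z u)
    (show 0 < min δ (e / (2 * (M + 1))) by positivity)] with w hw
  rw [mem_closedBall_iff_norm, le_min_iff] at hw
  obtain ⟨hw1, hw2⟩ := hw
  set d := w - quad x y z u with hd
  have hdx : d.fst = w.fst - x := rfl
  have hdy : d.snd.fst = w.snd.fst - y := rfl
  have hdz : d.snd.snd.fst = w.snd.snd.fst - z := rfl
  have hdu : d.snd.snd.snd = w.snd.snd.snd - u := rfl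
  have nx : ‖d.fst‖ ≤ ‖d‖ := WithLp.norm_fst_le (x := d)
  have n2 : ‖d.snd‖ ≤ ‖d‖ := WithLp.norm_snd_le (x := d)
  have ny : ‖d.snd.fst‖ ≤ ‖d‖ := (WithLp.norm_fst_le (x := d.snd)).trans n2
  have nz : ‖d.snd.snd.fst‖ ≤ ‖d‖ :=
    (WithLp.norm_fst_le (x := d.snd.snd)).trans ((WithLp.norm_snd_le (x := d.snd)).trans n2)
  have hgz := hnear d.snd.snd.fst (nz.trans hw1)
  rw [hdz, add_sub_cancel] at hgz
  obtain ⟨cg', hcg'⟩ := exists_real_of_mem_dom hgp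
    (ne_of_lt (hgz.trans_lt (EReal.coe_lt_top _)))
  rw [hcg', EReal.coe_le_coe_iff] at hgz
  by_cases hbad : w.fst ∉ S ∨ conj f w.snd.fst = ⊤
  · rw [merit_eq_top hfp.2 hcg' hbad]; exact le_top
  rw [not_or, not_not] at hbad
  obtain ⟨hxS, hfy⟩ := hbad
  obtain ⟨cf', hcf'⟩ := exists_real_of_mem_dom hfp hfy
  rw [merit_eq hxS hcg' hcf', EReal.coe_le_coe_iff, inner_quad]
  have i1 := hv' w.snd.fst
  rw [hcf', EReal.coe_le_coe_iff] at i1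
  have i2 := (mem_normalCone_iff hx).1 hν _ hxS
  have key := meritReal_add_ge (A := A) (K := K) (x := x) (y := y) (z := z) (u := u)
    (du := d.snd.snd.snd) hφ hℓφ hα hαt
    nx ny nz (half_pos he).le hgz i1 i2
  have ex : x + d.fst = w.fst := by rw [hdx]; abel
  have ey : y + d.snd.fst = w.snd.fst := by rw [hdy]; abel
  have ez : z + d.snd.snd.fst = w.snd.snd.fst := by rw [hdz]; abel
  have eu : u + d.snd.snd.snd = w.snd.snd.snd := by rw [hdu]; abel
  rw [ex, ey, ez, eu] at key
  refine le_trans ?_ key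
  have b7 : M * ‖d‖ ^ 2 ≤ e / 2 * ‖d‖ := by
    have h1 : M * ‖d‖ ≤ e / 2 := by
      rw [le_div_iff₀ (by positivity)] at hw2
      nlinarith [norm_nonneg d]
    have h2 := mul_le_mul_of_nonneg_right h1 (norm_nonneg d)
    linarith
  refine sub_le_sub le_rfl ?_
  rw [← hM]
  linarith

end Merit

/-! ### Finite length from the Kurdyka-Łojasiewicz inequality -/

theorem concave_decrease {η : EReal} {ψ : ℝ → ℝ}
    (hconc : ConcaveOn ℝ {s : ℝ | 0 ≤ s ∧ (s : EReal) < η} ψ) {s t : ℝ} (hs : 0 < s)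
    (hsη : (s : EReal) < η) (hd : DifferentiableAt ℝ ψ s) (ht0 : 0 ≤ t) (hts : t ≤ s) :
    deriv ψ s * (s - t) ≤ ψ s - ψ t := by
  rcases hts.eq_or_lt with rfl | hlt
  · simp
  have h1 := hconc.deriv_le_slope (x := t) (y := s)
    ⟨ht0, (EReal.coe_lt_coe_iff.2 hlt).trans hsη⟩ ⟨hs.le, hsη⟩ hlt hd
  rw [slope_def_field, le_div_iff₀ (sub_pos.2 hlt)] at h1
  exact h1

theorem tendsto_zero_of_sufficient_decrease {D h : ℕ → ℝ} {hlim c : ℝ} (hc : 0 < c)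
    (hD : ∀ k, 0 ≤ D k) (hdesc : ∀ k, h (k + 1) + c * D (k + 1) ^ 2 ≤ h k)
    (hh : Tendsto h atTop (𝓝 hlim)) : Tendsto D atTop (𝓝 0) := by
  refine (tendsto_add_atTop_iff_nat 1).1 ?_
  have h1 : Tendsto (fun k => (h k - h (k + 1)) / c) atTop (𝓝 0) := by
    simpa using (hh.sub ((tendsto_add_atTop_iff_nat 1).2 hh)).div_const c
  have h2 : Tendsto (fun k => D (k + 1) ^ 2) atTop (𝓝 0) := by
    refine squeeze_zero (fun k => sq_nonneg _) (fun k => ?_) h1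
    rw [le_div_iff₀ hc]
    linarith [hdesc k]
  have h3 := (Real.continuous_sqrt.tendsto 0).comp h2
  rw [Real.sqrt_zero] at h3
  exact h3.congr fun k => Real.sqrt_sq (hD (k + 1))

/-- The abstract Kurdyka-Łojasiewicz argument: sufficient decrease of the values `h k` along a
sequence `w`, and a subgradient bound `b * D k` which enters through the inequality `hKL`, make the
step lengths `D k` summable as soon as `w` has a cluster point near which `hKL` holds. -/
theorem summable_of_kurdyka_lojasiewicz {W : Type*} [PseudoMetricSpace W] {w : ℕ → W}
    {D h : ℕ → ℝ} {hlim b c : ℝ} {wb : W} {U : Set W} {η : EReal} {ψ : ℝ → ℝ}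
    (hb : 0 < b) (hc : 0 < c) (hD : ∀ k, 0 ≤ D k)
    (hdesc : ∀ k, h (k + 1) + c * D (k + 1) ^ 2 ≤ h k) (hh : Tendsto h atTop (𝓝 hlim))
    (hstep : ∀ k, dist (w (k + 1)) (w k) ≤ D (k + 1) + D k)
    (hwb : MapClusterPt wb atTop w) (hU : IsOpen U) (hwbU : wb ∈ U) (hη : 0 < η)
    (hconc : ConcaveOn ℝ {s : ℝ | 0 ≤ s ∧ (s : EReal) < η} ψ)
    (hcont : ContinuousOn ψ {s : ℝ | 0 ≤ s ∧ (s : EReal) < η})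
    (hpos : ∀ s : ℝ, 0 ≤ s → (s : EReal) < η → 0 ≤ ψ s) (hψ0 : ψ 0 = 0)
    (hder : ∀ s : ℝ, 0 < s → (s : EReal) < η → DifferentiableAt ℝ ψ s ∧ 0 < deriv ψ s)
    (hKL : ∀ k, w k ∈ U → hlim < h k → ((h k - hlim : ℝ) : EReal) < η →
      1 ≤ deriv ψ (h k - hlim) * (b * D k)) :
    Summable D := by
  have hanti : Antitone h := antitone_nat_of_succ_le fun k => by
    have := hdesc k
    nlinarith [sq_nonneg (D (k + 1))]
  have hge : ∀ k, hlim ≤ h k := hanti.le_of_tendsto hh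
  by_cases hfin : ∃ k, h k ≤ hlim
  · -- the values are eventually constant, so the steps vanish
    obtain ⟨k₀, hk₀⟩ := hfin
    refine (summable_nat_add_iff (k₀ + 1)).1 ?_
    have hz : ∀ j, D (j + (k₀ + 1)) = 0 := by
      intro j
      have h1 := hdesc (j + k₀)
      have h2 : h (j + k₀) ≤ hlim := (hanti (Nat.le_add_left k₀ j)).trans hk₀
      have h3 := hge (j + k₀ + 1)
      have h4 : c * D (j + k₀ + 1) ^ 2 ≤ 0 := by linarith
      have h5 : D (j + k₀ + 1) ^ 2 ≤ 0 := nonpos_of_mul_nonpos_right h4 hc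
      exact pow_eq_zero_iff two_ne_zero |>.1 (le_antisymm h5 (sq_nonneg _))
    simp only [hz]
    exact summable_zero
  push Not at hfin
  obtain ⟨R, hR, hball⟩ := Metric.isOpen_iff.1 hU wb hwbU
  set I : Set ℝ := {s : ℝ | 0 ≤ s ∧ (s : EReal) < η} with hI
  have hs0 : Tendsto (fun k => h k - hlim) atTop (𝓝 0) := by
    simpa using hh.sub_const hlim
  have hsη : ∀ᶠ k in atTop, ((h k - hlim : ℝ) : EReal) < η := by
    have := (continuous_coe_real_ereal.tendsto (0 : ℝ)).comp hs0
    exact this.eventually_lt_const (by simpa using hη)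
  have hψlim : Tendsto (fun k => ψ (h k - hlim)) atTop (𝓝 0) := by
    have h1 : ContinuousWithinAt ψ I 0 := hcont 0 ⟨le_rfl, by simpa using hη⟩
    rw [ContinuousWithinAt, hψ0] at h1
    refine h1.comp (tendsto_nhdsWithin_iff.2 ⟨hs0, ?_⟩)
    filter_upwards [hsη] with k hk using ⟨sub_nonneg.2 (hge k), hk⟩
  have hDlim : ∀ e : ℝ, 0 < e → ∀ᶠ k in atTop, D k < e :=
    fun e he => (tendsto_zero_of_sufficient_decrease hc hD hdesc hh).eventually_lt_const he
  -- a starting index from which the remaining length is too short to leave the ball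
  obtain ⟨k₀, hk₀w, hk₀D, hk₀ψ, hk₀η⟩ : ∃ k₀, dist (w k₀) wb < R / 4 ∧ D k₀ < R / 8 ∧
      b / c * ψ (h k₀ - hlim) < R / 8 ∧ ((h k₀ - hlim : ℝ) : EReal) < η := by
    have h1 : ∃ᶠ k in atTop, dist (w k) wb < R / 4 :=
      hwb.frequently (Metric.ball_mem_nhds wb (by positivity))
    have h2 : ∀ᶠ k in atTop, b / c * ψ (h k - hlim) < R / 8 := by
      have h3 := hψlim.const_mul (b / c)
      rw [mul_zero] at h3
      exact h3.eventually_lt_const (by positivity)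
    exact (h1.and_eventually ((hDlim (R / 8) (by positivity)).and (h2.and hsη))).exists
  have hη' : ∀ j, ((h (k₀ + j) - hlim : ℝ) : EReal) < η := fun j =>
    (EReal.coe_le_coe_iff.2 (sub_le_sub_right (hanti (Nat.le_add_right k₀ j)) _)).trans_lt hk₀η
  have hrec : ∀ j, w (k₀ + j) ∈ U → 2 * D (k₀ + j + 1) ≤ D (k₀ + j)
      + b / c * (ψ (h (k₀ + j) - hlim) - ψ (h (k₀ + j + 1) - hlim)) := by
    intro j hj
    set k := k₀ + j
    have hsk : 0 < h k - hlim := sub_pos.2 (hfin k)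
    have h1 := hKL k hj (hfin k) (hη' j)
    obtain ⟨hdiff, hdpos⟩ := hder _ hsk (hη' j)
    have h2 := concave_decrease hconc hsk (hη' j) hdiff (t := h (k + 1) - hlim)
      (sub_nonneg.2 (hge _)) (sub_le_sub_right (hanti (Nat.le_succ k)) _)
    set ψ' := deriv ψ (h k - hlim)
    set P := ψ (h k - hlim) - ψ (h (k + 1) - hlim)
    have h3 : ψ' * (c * D (k + 1) ^ 2) ≤ P := by
      refine le_trans (mul_le_mul_of_nonneg_left ?_ hdpos.le) h2
      linarith [hdesc k]
    have h4 : c * D (k + 1) ^ 2 ≤ b * D k * P := by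
      have h5 : c * D (k + 1) ^ 2 * 1 ≤ c * D (k + 1) ^ 2 * (ψ' * (b * D k)) :=
        mul_le_mul_of_nonneg_left h1 (by positivity)
      have h6 := mul_le_mul_of_nonneg_left h3 (mul_nonneg hb.le (hD k))
      linarith
    have hP : 0 ≤ P := le_trans (by positivity) h3
    have h7 : D (k + 1) ^ 2 ≤ D k * (b / c * P) := by
      rw [show D k * (b / c * P) = b * D k * P / c by ring, le_div_iff₀ hc]
      linarith
    have h8 : D (k + 1) ≤ (D k + b / c * P) / 2 := by
      have : 0 ≤ b / c * P := by positivity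
      refine le_of_sq_le_sq ?_ (by have := hD k; positivity)
      nlinarith [sq_nonneg (D k - b / c * P)]
    linarith
  set σ : ℕ → ℝ := fun j => ∑ i ∈ Finset.range j, D (k₀ + i + 1) with hσ
  have key : ∀ j, dist (w (k₀ + j)) (w k₀) + D (k₀ + j) ≤ 2 * σ j + D k₀ ∧
      σ j + D (k₀ + j) ≤ D k₀ + b / c * (ψ (h k₀ - hlim) - ψ (h (k₀ + j) - hlim)) := by
    intro j
    induction j with
    | zero => simp [hσ]
    | succ j ih =>
      obtain ⟨ih1, ih2⟩ := ih
      have hψj := mul_nonneg (div_pos hb hc).le (hpos _ (sub_nonneg.2 (hge (k₀ + j))) (hη' j))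
      have hin : w (k₀ + j) ∈ U := by
        refine hball (Metric.mem_ball.2 ?_)
        have h1 := dist_triangle (w (k₀ + j)) (w k₀) wb
        have h2 := hD (k₀ + j)
        rw [mul_sub] at ih2
        linarith
      have hr := hrec j hin
      have hσs : σ (j + 1) = σ j + D (k₀ + j + 1) := Finset.sum_range_succ _ _
      have h3 := dist_triangle (w (k₀ + j + 1)) (w (k₀ + j)) (w k₀)
      have h4 := hstep (k₀ + j)
      rw [← add_assoc, hσs]
      rw [mul_sub] at hr ih2 ⊢
      constructor <;> linarith
  refine (summable_nat_add_iff (k₀ + 1)).1 ?_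
  refine summable_of_sum_range_le (c := D k₀ + b / c * ψ (h k₀ - hlim)) (fun j => hD _)
    fun j => ?_
  have h1 := (key j).2
  have hψj := mul_nonneg (div_pos hb hc).le (hpos _ (sub_nonneg.2 (hge (k₀ + j))) (hη' j))
  have h2 : ∑ i ∈ Finset.range j, D (i + (k₀ + 1)) = σ j :=
    Finset.sum_congr rfl fun i _ => by congr 1; ring
  rw [h2]
  rw [mul_sub] at h1
  linarith [hD (k₀ + j)]

/-! ### Bounds coming from the interiority assumptions -/

theorem intrinsicInterior_subset_interior {H : Type*} [NormedAddCommGroup H] [NormedSpace ℝ H]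
    {C : Set H} (hC : (interior C).Nonempty) : intrinsicInterior ℝ C ⊆ interior C := by
  have htop : affineSpan ℝ C = ⊤ :=
    top_unique ((isOpen_interior.affineSpan_eq_top hC).ge.trans
      (affineSpan_mono ℝ interior_subset))
  have hopen : IsOpen (affineSpan ℝ C : Set H) := by
    rw [htop]; exact isOpen_univ
  refine interior_maximal intrinsicInterior_subset ?_
  exact hopen.isOpenMap_subtype_val _ isOpen_interior

/-- If `h` is `L`-Lipschitz near `w`, then a subgradient `z` of `h` at a point `q` with
`w - q = t z`, `t > 0`, is bounded by `L`: convexity carries the slope bound at `w` along the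
segment to `q`. -/
theorem norm_subgradient_le_of_lipschitz {H : Type*} [NormedAddCommGroup H]
    [InnerProductSpace ℝ H] {h : H → EReal} (hp : Proper h) (hc : ConvexFun h) {w q z : H} {t : ℝ}
    {L : ℝ≥0} {N : Set H} (hN : N ∈ 𝓝 w) (hNd : N ⊆ dom h)
    (hL : LipschitzOnWith L (fun v => (h v).toReal) N) (hz : z ∈ convSubdiff h q) (ht : 0 < t)
    (hw : w - q = t • z) : ‖z‖ ≤ L := by
  obtain ⟨gq, hgq, h1⟩ := mem_convSubdiff_iff.1 hz
  obtain ⟨gw, hgw⟩ := exists_real_of_mem_dom hp (ne_of_lt (hNd (mem_of_mem_nhds hN)))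
  have h2 := h1 w
  rw [hgw, EReal.coe_le_coe_iff, hw, inner_smul_right, real_inner_self_eq_norm_sq] at h2
  have hcont : Tendsto (fun τ : ℝ => w + τ • (q - w)) (𝓝[>] 0) (𝓝 w) := by
    refine Tendsto.mono_left ?_ nhdsWithin_le_nhds
    have : Continuous fun τ : ℝ => w + τ • (q - w) := by fun_prop
    simpa using this.tendsto 0
  obtain ⟨τ, hτN, hτ⟩ := ((hcont.eventually_mem hN).and
    (eventually_mem_set.2 (Ioc_mem_nhdsGT (zero_lt_one' ℝ)))).exists
  obtain ⟨c, hcv⟩ := exists_real_of_mem_dom hp (ne_of_lt (hNd hτN))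
  have h3 := hc.le_combo hgw.le hgq.le (a := 1 - τ) (b := τ) (by linarith [hτ.2]) hτ.1.le (by ring)
  have h4 : (1 - τ) • w + τ • q = w + τ • (q - w) := by module
  rw [h4, hcv, EReal.coe_le_coe_iff] at h3
  have h5 := hL.dist_le_mul _ hτN _ (mem_of_mem_nhds hN)
  have h6 : q - w = -(t • z) := by rw [← hw]; abel
  simp only [hcv, hgw, EReal.toReal_coe] at h5
  rw [Real.dist_eq, dist_eq_norm, add_sub_cancel_left, h6, smul_neg, norm_neg, norm_smul,
    norm_smul, Real.norm_of_nonneg hτ.1.le, Real.norm_of_nonneg ht.le] at h5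
  have h7 := (abs_le.1 h5).1
  have h8 : τ * (t * ‖z‖ ^ 2) ≤ τ * (L * (t * ‖z‖)) := by nlinarith [hτ.1]
  have h9 := le_of_mul_le_mul_left h8 hτ.1
  have h10 : t * (‖z‖ ^ 2) ≤ t * (L * ‖z‖) := by linarith
  have h11 := le_of_mul_le_mul_left h10 ht
  by_contra hcon
  rw [not_le] at hcon
  have := L.coe_nonneg
  nlinarith [norm_nonneg z]

/-- The conjugate `h*` grows linearly, uniformly over slopes in a compact subset of the interior
of `dom h`. -/
theorem exists_conj_sub_inner_ge {H : Type*} [NormedAddCommGroup H] [InnerProductSpace ℝ H]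
    [FiniteDimensional ℝ H] {h : H → EReal} (hp : Proper h) (hc : ConvexFun h) {C : Set H}
    (hC : IsCompact C) (hCd : C ⊆ interior (dom h)) :
    ∃ δ M : ℝ, 0 < δ ∧ ∀ v ∈ C, ∀ (y : H) (c : ℝ), conj h y = c → δ * ‖y‖ - M ≤ c - ⟪v, y⟫ := by
  obtain ⟨δ, hδ, hsub⟩ := hC.exists_cthickening_subset_open isOpen_interior hCd
  have hdom : ∀ v ∈ dom h, h v = ((h v).toReal : EReal) := fun v hv =>
    (EReal.coe_toReal (ne_of_lt hv) (hp.2 v)).symm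
  have hconv : ConvexOn ℝ (dom h) (fun v => (h v).toReal) := by
    have key : ∀ x ∈ dom h, ∀ y ∈ dom h, ∀ a b : ℝ, 0 ≤ a → 0 ≤ b → a + b = 1 →
        h (a • x + b • y) ≤ ((a * (h x).toReal + b * (h y).toReal : ℝ) : EReal) :=
      fun x hx y hy a b ha hb hab => hc.le_combo (hdom x hx).le (hdom y hy).le ha hb hab
    refine ⟨fun x hx y hy a b ha hb hab =>
      (key x hx y hy a b ha hb hab).trans_lt (EReal.coe_lt_top _), ?_⟩
    intro x hx y hy a b ha hb hab
    have h1 := key x hx y hy a b ha hb hab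
    rw [hdom _ (show a • x + b • y ∈ dom h from h1.trans_lt (EReal.coe_lt_top _)),
      EReal.coe_le_coe_iff] at h1
    exact h1
  obtain ⟨M, hM⟩ := (hC.cthickening (r := δ)).exists_bound_of_continuousOn
    (hconv.continuousOn_interior.mono hsub)
  refine ⟨δ, M, hδ, fun v hv y c hcy => ?_⟩
  set u := v + (δ / ‖y‖) • y with hu
  have hun : ‖(δ / ‖y‖) • y‖ ≤ δ := by
    rw [norm_smul, Real.norm_of_nonneg (by positivity)]
    rcases eq_or_ne ‖y‖ 0 with h0 | h0
    · simp [h0, hδ.le]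
    · rw [div_mul_cancel₀ _ h0]
  have humem : u ∈ Metric.cthickening δ C :=
    Metric.mem_cthickening_of_dist_le u v δ C hv (by rwa [dist_eq_norm, hu, add_sub_cancel_left])
  have h1 := conj_ge (hdom u (interior_subset (hsub humem))).le y
  rw [hcy, EReal.coe_le_coe_iff] at h1
  have h2 := (abs_le.1 (hM u humem)).2
  have h3 : ⟪y, u⟫ = ⟪v, y⟫ + δ * ‖y‖ := by
    rw [hu, inner_add_right, inner_smul_right, real_inner_self_eq_norm_sq, real_inner_comm]
    rcases eq_or_ne ‖y‖ 0 with h0 | h0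
    · simp [h0]
    · field_simp
  rw [h3] at h1
  linarith

theorem mem_nhds_nbhd {n s : ℕ} {S : Set (E n)} {A : E n →L[ℝ] E s} {r : ℝ} {x : E n} (hx : x ∈ S)
    {w : E s} (hw : ‖w - A x‖ < r) : nbhd S A r ∈ 𝓝 w := by
  have h1 : Metric.infDist w (A '' S) < r :=
    (Metric.infDist_le_dist_of_mem (mem_image_of_mem A hx)).trans_lt (by rwa [dist_eq_norm])
  have h2 := (Metric.continuous_infDist_pt (A '' S)).tendsto w
  filter_upwards [h2.eventually_lt_const h1] with v hv using hv.le

/-! ### The algorithm with a constant parameter -/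

section ConstStep

variable {n p s : ℕ}

/-- Sequences satisfying the optimality conditions of the three steps of the algorithm, with the
parameters `α_k = αt` and `ρ_k = ρ` constant, and with `z k` bounded by `Z`. Indices are shifted so
that already `x 0` belongs to `S`. -/
structure IsConstStepRun (S : Set (E n)) (g : E s → EReal) (φ : E n → ℝ) (f : E p → EReal)
    (A : E n →L[ℝ] E s) (K : E n →L[ℝ] E p) (α αt ρ βlo βhi Z : ℝ) (β : ℕ → ℝ)
    (x : ℕ → E n) (y : ℕ → E p) (z : ℕ → E s) : Prop where
  mem : ∀ k, x k ∈ S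
  z_le : ∀ k, ‖z k‖ ≤ Z
  β_mem : ∀ k, βlo ≤ β k ∧ β k ≤ βhi
  x_step : ∀ k, ρ • (x k - x (k + 1)) - gradient φ (x k) + ContinuousLinearMap.adjoint K (y k)
    - ContinuousLinearMap.adjoint A (z k) ∈ normalCone S (x (k + 1))
  y_step : ∀ k, K (x (k + 1)) - β k • (y (k + 1) - y k) ∈ convSubdiff (conj f) (y (k + 1))
  z_step : ∀ k, A (x (k + 1)) + α • z k - αt • z (k + 1) ∈ convSubdiff (conj g) (z (k + 1))

theorem IsProj.mem_normalCone {S : Set (E n)} (hS : Convex ℝ S) {w q : E n} (hq : IsProj S w q)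
    {ρ : ℝ} (hρ : 0 ≤ ρ) : ρ • (w - q) ∈ normalCone S q := by
  rw [mem_normalCone_iff hq.1]
  intro c hc
  have : Nonempty S := ⟨⟨q, hq.1⟩⟩
  have h1 : ‖w - q‖ = ⨅ c : S, ‖w - c‖ := le_antisymm (le_ciInf fun c => hq.2 c c.2)
    (ciInf_le ⟨0, by rintro _ ⟨c, rfl⟩; exact norm_nonneg _⟩ (⟨q, hq.1⟩ : S))
  have h2 := (norm_eq_iInf_iff_real_inner_le_zero hS hq.1).1 h1 c hc
  rw [inner_smul_left]
  exact mul_nonpos_of_nonneg_of_nonpos hρ h2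

/-- The estimate behind the decrease of the merit function in the `z`-step. Here `n₀` and `n` are
the lengths of two consecutive `z`-steps, `X` the length of the `x`-step, and
`(α + θ) n ^ 2 ≤ I + α * J` expresses the monotonicity of `∂g*`; it enters with the weight
`4 * α / θ`. -/
theorem dual_step_bound {α θ γ σ X n n₀ I J : ℝ} (hα : 0 < α) (hθ : 0 < θ) (hθγ : θ ≤ γ)
    (hαγ : α < γ / 2) (hJ : J ≤ n * n₀)
    (hmono : (α + θ) * n ^ 2 ≤ I + α * J) (hI : I ≤ σ * X * n) :
    I + α * J + α / 2 * (1 + 4 * α / θ) * n ^ 2 - α / 2 * (1 + 4 * α / θ) * n₀ ^ 2 - θ / 2 * n ^ 2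
      ≤ 3 * σ ^ 2 * γ / (2 * θ ^ 2) * X ^ 2 - α * n ^ 2 := by
  have hJ' : α * J ≤ α / 2 * n ^ 2 + α / 2 * n₀ ^ 2 := by
    nlinarith [sq_nonneg (n - n₀), mul_le_mul_of_nonneg_left hJ hα.le]
  have h1 := mul_le_mul_of_nonneg_left (hmono.trans (add_le_add_right hJ' I))
    (show 0 ≤ 4 * α / θ by positivity)
  set k := 4 * α / θ with hk
  have hkθ : k * θ = 4 * α := div_mul_cancel₀ _ hθ.ne'
  have h2 : (1 + k) * I ≤ (θ / 2 + 2 * α) * n ^ 2 + 3 * σ ^ 2 * γ / (2 * θ ^ 2) * X ^ 2 := by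
    set m := σ * X / θ with hm
    have hmθ : m * θ = σ * X := div_mul_cancel₀ _ hθ.ne'
    have e1 : 3 * σ ^ 2 * γ / (2 * θ ^ 2) * X ^ 2 = 3 * γ / 2 * m ^ 2 := by
      rw [hm]; field_simp
    have h3 : (1 + k) * I ≤ (1 + k) * (m * θ * n) := by
      rw [hmθ]; exact mul_le_mul_of_nonneg_left hI (by positivity)
    have h4 : (1 + k) * (m * θ * n) = (θ + 4 * α) * (m * n) := by
      linear_combination (m * n) * hkθ
    have h5 : (θ + 4 * α) * (m * n) ≤ (θ + 4 * α) * ((m ^ 2 + n ^ 2) / 2) :=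
      mul_le_mul_of_nonneg_left (by nlinarith [sq_nonneg (m - n)]) (by positivity)
    -- `θ ≤ γ` and `2 * α < γ` give `θ + 4 * α ≤ 3 * γ`
    have h6 : (θ + 4 * α) * (m ^ 2 / 2) ≤ 3 * γ * (m ^ 2 / 2) :=
      mul_le_mul_of_nonneg_right (by linarith) (by positivity)
    rw [e1]
    linarith
  have h7 : k * ((α + θ) * n ^ 2) = k * α * n ^ 2 + 4 * α * n ^ 2 := by
    linear_combination n ^ 2 * hkθ
  rw [h7] at h1
  nlinarith

/-- The length of the `k`-th step of the algorithm. -/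
noncomputable def stepLength (x : ℕ → E n) (y : ℕ → E p) (z : ℕ → E s) (k : ℕ) : ℝ :=
  ‖x (k + 1) - x k‖ + ‖y (k + 1) - y k‖ + ‖z (k + 1) - z k‖

/-- The value of the merit function after the `k`-th step. -/
noncomputable def meritSeq (g : E s → EReal) (φ : E n → ℝ) (f : E p → EReal) (A : E n →L[ℝ] E s)
    (K : E n →L[ℝ] E p) (α αt : ℝ) (x : ℕ → E n) (y : ℕ → E p) (z : ℕ → E s) (k : ℕ) : ℝ :=
  meritReal φ A K α αt (x (k + 1)) (y (k + 1)) (z (k + 1)) (z k)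
    (conj g (z (k + 1))).toReal (conj f (y (k + 1))).toReal

namespace IsConstStepRun

variable {S : Set (E n)} {g : E s → EReal} {φ : E n → ℝ} {f : E p → EReal}
    {A : E n →L[ℝ] E s} {K : E n →L[ℝ] E p} {α αt ρ βlo βhi Z : ℝ} {β : ℕ → ℝ}
    {x : ℕ → E n} {y : ℕ → E p} {z : ℕ → E s}

theorem conj_g_eq (h : IsConstStepRun S g φ f A K α αt ρ βlo βhi Z β x y z) (k : ℕ) :
    conj g (z (k + 1)) = ((conj g (z (k + 1))).toReal : EReal) :=
  (EReal.coe_toReal (h.z_step k).1 (h.z_step k).2.1).symm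

theorem conj_f_eq (h : IsConstStepRun S g φ f A K α αt ρ βlo βhi Z β x y z) (k : ℕ) :
    conj f (y (k + 1)) = ((conj f (y (k + 1))).toReal : EReal) :=
  (EReal.coe_toReal (h.y_step k).1 (h.y_step k).2.1).symm

theorem conj_g_ge (h : IsConstStepRun S g φ f A K α αt ρ βlo βhi Z β x y z) (k j : ℕ) :
    (conj g (z (k + 1))).toReal
      + ⟪A (x (k + 1)) + α • z k - αt • z (k + 1), z (j + 1) - z (k + 1)⟫
      ≤ (conj g (z (j + 1))).toReal := by
  have h1 := (h.z_step k).2.2 (z (j + 1))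
  rw [sub_zero, h.conj_g_eq k, h.conj_g_eq j] at h1
  exact_mod_cast h1

theorem conj_f_ge (h : IsConstStepRun S g φ f A K α αt ρ βlo βhi Z β x y z) (k j : ℕ) :
    (conj f (y (k + 1))).toReal + ⟪K (x (k + 1)) - β k • (y (k + 1) - y k), y (j + 1) - y (k + 1)⟫
      ≤ (conj f (y (j + 1))).toReal := by
  have h1 := (h.y_step k).2.2 (y (j + 1))
  rw [sub_zero, h.conj_f_eq k, h.conj_f_eq j] at h1
  exact_mod_cast h1

/-- Sufficient decrease of the merit function. -/
theorem meritSeq_decrease (h : IsConstStepRun S g φ f A K α αt ρ βlo βhi Z β x y z)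
    (hφ : Differentiable ℝ φ) {ℓφ : ℝ≥0} (hℓφ : LipschitzWith ℓφ (gradient φ)) {γ μ : ℝ}
    (hα : 0 < α) (hαt : α < αt) (hαtγ : αt ≤ α + γ) (hαγ : α < γ / 2)
    (hρ : ρ = rhoOf ℓφ (sigmaMax A) γ μ α αt) (k : ℕ) :
    meritSeq g φ f A K α αt x y z (k + 1) + (μ * ‖x (k + 1 + 1) - x (k + 1)‖ ^ 2
      + βlo * ‖y (k + 1 + 1) - y (k + 1)‖ ^ 2 + α * ‖z (k + 1 + 1) - z (k + 1)‖ ^ 2)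
      ≤ meritSeq g φ f A K α αt x y z k := by
  have hG := h.conj_g_ge k (k + 1)
  have hF := h.conj_f_ge (k + 1) k
  have hM := convSubdiff_monotone (h.z_step (k + 1)) (h.z_step k)
  have hX := (mem_normalCone_iff (h.mem _)).1 (h.x_step (k + 1)) _ (h.mem (k + 1))
  have hβ := (h.β_mem (k + 1)).1
  rw [meritSeq, meritSeq, meritReal, meritReal]
  generalize β (k + 1) = b at *
  generalize (conj g (z (k + 1 + 1))).toReal = cg₂ at *
  generalize (conj g (z (k + 1))).toReal = cg₁ at *
  generalize (conj f (y (k + 1 + 1))).toReal = cf₂ at *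
  generalize (conj f (y (k + 1))).toReal = cf₁ at *
  have hX2 := le_quadratic_of_lipschitz_gradient hφ hℓφ (x (k + 1)) (x (k + 1 + 1))
  generalize x (k + 1 + 1) = x₂ at *
  generalize y (k + 1 + 1) = y₂ at *
  generalize z (k + 1 + 1) = z₂ at *
  generalize x (k + 1) = x₁ at *
  generalize y (k + 1) = y₁ at *
  generalize z (k + 1) = z₁ at *
  generalize z k = z₀ at *
  obtain ⟨dx, rfl⟩ : ∃ d, x₂ = x₁ + d := ⟨_, (add_sub_cancel _ _).symm⟩
  obtain ⟨dy, rfl⟩ : ∃ d, y₂ = y₁ + d := ⟨_, (add_sub_cancel _ _).symm⟩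
  obtain ⟨dz, rfl⟩ : ∃ d, z₂ = z₁ + d := ⟨_, (add_sub_cancel _ _).symm⟩
  obtain ⟨d₀, rfl⟩ : ∃ d, z₀ = z₁ - d := ⟨_, (sub_sub_cancel _ _).symm⟩
  have hθ : 0 < αt - α := sub_pos.2 hαt
  have e1 : A (x₁ + dx) + α • z₁ - αt • (z₁ + dz) - (A x₁ + α • (z₁ - d₀) - αt • z₁)
      = A dx + α • d₀ - αt • dz := by
    rw [map_add, smul_add, smul_sub]; abel
  have e2 : A x₁ + α • (z₁ - d₀) - αt • z₁ = A x₁ - α • d₀ - (αt - α) • z₁ := by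
    module
  have e3 : x₁ - (x₁ + dx) = -dx := by abel
  have e4 : y₁ - (y₁ + dy) = -dy := by abel
  rw [e1, add_sub_cancel_left, inner_sub_left, inner_add_left, inner_smul_left, inner_smul_left,
    real_inner_self_eq_norm_sq] at hM
  rw [e2, add_sub_cancel_left, inner_sub_left, inner_sub_left, inner_smul_left,
    inner_smul_left] at hG
  rw [e4, add_sub_cancel_left, inner_neg_right, inner_sub_left, inner_smul_left,
    real_inner_self_eq_norm_sq, map_add, inner_add_left] at hF
  rw [e3, inner_neg_right, inner_sub_left, inner_add_left, inner_sub_left, inner_smul_left,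
    inner_neg_left, real_inner_self_eq_norm_sq, ContinuousLinearMap.adjoint_inner_left,
    ContinuousLinearMap.adjoint_inner_left] at hX
  rw [add_sub_cancel_left] at hX2
  simp only [conj_trivial] at hM hG hF hX
  have hD := dual_step_bound (α := α) (θ := αt - α) (γ := γ) (σ := ‖A‖) (X := ‖dx‖) (n := ‖dz‖)
    (n₀ := ‖d₀‖) (I := ⟪A dx, dz⟫) (J := ⟪d₀, dz⟫) hα hθ (by linarith) hαγ
    (by rw [mul_comm]; exact real_inner_le_norm _ _)
    (by rw [add_sub_cancel]; linarith)
    ((real_inner_le_norm _ _).trans (mul_le_mul_of_nonneg_right (A.le_opNorm dx) (norm_nonneg _)))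
  rw [sigmaMax_eq] at hρ
  have hρ' : ρ * ‖dx‖ ^ 2 = ℓφ / 2 * ‖dx‖ ^ 2
      + 3 * ‖A‖ ^ 2 * γ / (2 * (αt - α) ^ 2) * ‖dx‖ ^ 2 + μ * ‖dx‖ ^ 2 := by
    rw [hρ, rhoOf]; ring
  have hβ' : βlo * ‖dy‖ ^ 2 ≤ b * ‖dy‖ ^ 2 := mul_le_mul_of_nonneg_right hβ (sq_nonneg _)
  have e5 : ⟪z₁ + dz, A (x₁ + dx)⟫ = ⟪z₁, A x₁⟫ + ⟪z₁, A dx⟫ + ⟪A x₁, dz⟫ + ⟪A dx, dz⟫ := by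
    rw [map_add, inner_add_left, inner_add_right, inner_add_right, real_inner_comm dz (A x₁),
      real_inner_comm dz (A dx)]
    ring
  have e6 : ⟪K (x₁ + dx), y₁ + dy⟫ = ⟪K x₁, y₁⟫ + ⟪K x₁, dy⟫ + ⟪y₁, K dx⟫ + ⟪K dx, dy⟫ := by
    rw [map_add, inner_add_left, inner_add_right, inner_add_right, real_inner_comm (K dx) y₁]
    ring
  have e7 : ‖z₁ + dz‖ ^ 2 = ‖z₁‖ ^ 2 + 2 * ⟪z₁, dz⟫ + ‖dz‖ ^ 2 := norm_add_sq_real z₁ dz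
  rw [e5, e6, e7]
  simp only [add_sub_cancel_left, sub_sub_cancel]
  linarith

/-- A limiting subgradient of the merit function bounded by the step length. -/
theorem exists_subgradient_le (h : IsConstStepRun S g φ f A K α αt ρ βlo βhi Z β x y z)
    (hgess : EssStrictlyConvex g) (hgconv : ConvexFun g)
    (hglsc : LowerSemicontinuous g) (hf : Proper f) (hfconv : ConvexFun f)
    (hflsc : LowerSemicontinuous f) (hφ : Differentiable ℝ φ) {ℓφ : ℝ≥0}
    (hℓφ : LipschitzWith ℓφ (gradient φ)) (hα : 0 < α) (hαt : α < αt) (hρ : 0 ≤ ρ)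
    (hβlo : 0 ≤ βlo) (k : ℕ) :
    ∃ V ∈ limSubdiff (merit S g φ f A K α αt) (quad (x (k + 1)) (y (k + 1)) (z (k + 1)) (z k)),
      ‖V‖ ≤ (ℓφ + ρ + ‖A‖ + ‖K‖ + βhi + α + 4 * (α / 2 * (1 + 4 * α / (αt - α))))
        * stepLength x y z k := by
  refine ⟨_, frechetSubdiff_subset_limSubdiff _ _ (mem_frechetSubdiff_merit (u := z k) hgess hgconv
    hglsc hf hfconv hflsc hφ hℓφ hα hαt (h.mem (k + 1)) (h.x_step k) (h.y_step k) (h.z_step k)),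
    (norm_quad_le _ _ _ _).trans ?_⟩
  rw [stepLength]
  obtain ⟨hβ1, hβ2⟩ := h.β_mem k
  generalize β k = b at *
  have hL := hℓφ.norm_sub_le (x (k + 1)) (x k)
  generalize x (k + 1) = x₁ at *
  generalize y (k + 1) = y₁ at *
  generalize z (k + 1) = z₁ at *
  generalize x k = x₀ at *
  generalize y k = y₀ at *
  generalize z k = z₀ at *
  have hθ : 0 < αt - α := sub_pos.2 hαt
  have hC0 : 0 ≤ α / 2 * (1 + 4 * α / (αt - α)) := by positivity
  generalize α / 2 * (1 + 4 * α / (αt - α)) = C at hC0 ⊢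
  have v1 : gradient φ x₁ + ContinuousLinearMap.adjoint A z₁ - ContinuousLinearMap.adjoint K y₁
      + (ρ • (x₀ - x₁) - gradient φ x₀ + ContinuousLinearMap.adjoint K y₀
        - ContinuousLinearMap.adjoint A z₀)
      = (gradient φ x₁ - gradient φ x₀) + ContinuousLinearMap.adjoint A (z₁ - z₀)
        - ContinuousLinearMap.adjoint K (y₁ - y₀) - ρ • (x₁ - x₀) := by
    rw [map_sub, map_sub, smul_sub, smul_sub]; abel
  have v2 : K x₁ - b • (y₁ - y₀) - K x₁ = -(b • (y₁ - y₀)) := by abel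
  have v3 : A x₁ - (A x₁ + α • z₀ - αt • z₁) + (2 * C) • (z₁ - z₀) - (αt - α) • z₁
      = (α + 2 * C) • (z₁ - z₀) := by module
  rw [v1, v2, v3, norm_neg, norm_neg, norm_smul, norm_smul, norm_smul,
    Real.norm_of_nonneg (hβlo.trans hβ1), Real.norm_of_nonneg (by positivity : 0 ≤ α + 2 * C),
    Real.norm_of_nonneg (by positivity : 0 ≤ 2 * C)]
  have hA : ‖ContinuousLinearMap.adjoint A (z₁ - z₀)‖ ≤ ‖A‖ * ‖z₁ - z₀‖ := by
    have := (ContinuousLinearMap.adjoint A).le_opNorm (z₁ - z₀)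
    rwa [LinearIsometryEquiv.norm_map] at this
  have hK : ‖ContinuousLinearMap.adjoint K (y₁ - y₀)‖ ≤ ‖K‖ * ‖y₁ - y₀‖ := by
    have := (ContinuousLinearMap.adjoint K).le_opNorm (y₁ - y₀)
    rwa [LinearIsometryEquiv.norm_map] at this
  have t1 := norm_sub_le ((gradient φ x₁ - gradient φ x₀)
    + ContinuousLinearMap.adjoint A (z₁ - z₀) - ContinuousLinearMap.adjoint K (y₁ - y₀))
    (ρ • (x₁ - x₀))
  have t2 := norm_sub_le ((gradient φ x₁ - gradient φ x₀)
    + ContinuousLinearMap.adjoint A (z₁ - z₀)) (ContinuousLinearMap.adjoint K (y₁ - y₀))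
  have t3 := norm_add_le (gradient φ x₁ - gradient φ x₀) (ContinuousLinearMap.adjoint A (z₁ - z₀))
  rw [norm_smul, Real.norm_of_nonneg hρ] at t1
  have t4 : b * ‖y₁ - y₀‖ ≤ βhi * ‖y₁ - y₀‖ := mul_le_mul_of_nonneg_right hβ2 (norm_nonneg _)
  have hβhi : 0 ≤ βhi := hβlo.trans (hβ1.trans hβ2)
  have hX := norm_nonneg (x₁ - x₀)
  have hY := norm_nonneg (y₁ - y₀)
  have hZ := norm_nonneg (z₁ - z₀)
  have hA0 := norm_nonneg A
  have hK0 := norm_nonneg K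
  have hℓ0 := ℓφ.coe_nonneg
  generalize ‖x₁ - x₀‖ = X at *
  generalize ‖y₁ - y₀‖ = Y at *
  generalize ‖z₁ - z₀‖ = W at *
  nlinarith [mul_nonneg hℓ0 hY, mul_nonneg hℓ0 hZ, mul_nonneg hρ hY, mul_nonneg hρ hZ,
    mul_nonneg hA0 hX, mul_nonneg hA0 hY, mul_nonneg hK0 hX, mul_nonneg hK0 hZ,
    mul_nonneg hβhi hX, mul_nonneg hβhi hZ, mul_nonneg hα.le hX, mul_nonneg hα.le hY,
    mul_nonneg hC0 hX, mul_nonneg hC0 hY]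

/-- The merit function is bounded below along the run and controls the dual variables `y`. -/
theorem exists_meritSeq_ge (h : IsConstStepRun S g φ f A K α αt ρ βlo βhi Z β x y z)
    (hS : IsCompact S) (hf : Proper f) (hfconv : ConvexFun f) (hK : K '' S ⊆ interior (dom f))
    (hφ : Differentiable ℝ φ) (hα : 0 < α) (hαt : α < αt) :
    ∃ δ B : ℝ, 0 < δ ∧ ∀ k, δ * ‖y (k + 1)‖ - B ≤ meritSeq g φ f A K α αt x y z k := by
  obtain ⟨δ, M, hδ, hM⟩ := exists_conj_sub_inner_ge hf hfconv (hS.image K.continuous) hK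
  obtain ⟨R, hR⟩ := hS.isBounded.exists_norm_le
  obtain ⟨m, hm⟩ := hS.exists_bound_of_continuousOn hφ.continuous.continuousOn
  have hθ : 0 < αt - α := sub_pos.2 hαt
  have hZ0 : 0 ≤ Z := (norm_nonneg _).trans (h.z_le 0)
  set Q := ‖A‖ * R + α * Z + αt * Z with hQ
  refine ⟨δ, M + Z * (‖A‖ * R) + (Q * (2 * Z) + (conj g (z (0 + 1))).toReal) + m
    + 1 / 2 * (αt - α) * Z ^ 2, hδ, fun k => ?_⟩
  have hA : ‖A (x (k + 1))‖ ≤ ‖A‖ * R := A.le_opNorm_of_le (hR _ (h.mem _))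
  rw [meritSeq, meritReal]
  have t1 := hM _ (mem_image_of_mem K (h.mem (k + 1))) _ _ (h.conj_f_eq k)
  have t2 : -(Z * (‖A‖ * R)) ≤ ⟪z (k + 1), A (x (k + 1))⟫ := by
    have h1 := (abs_le.1 (abs_real_inner_le_norm (z (k + 1)) (A (x (k + 1))))).1
    have h2 := mul_le_mul (h.z_le (k + 1)) hA (norm_nonneg _) hZ0
    linarith
  have t3 : (conj g (z (k + 1))).toReal ≤ Q * (2 * Z) + (conj g (z (0 + 1))).toReal := by
    have h1 := h.conj_g_ge k 0
    set q := A (x (k + 1)) + α • z k - αt • z (k + 1) with hq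
    have h2 := (abs_le.1 (abs_real_inner_le_norm q (z (0 + 1) - z (k + 1)))).1
    have h3 : ‖q‖ ≤ Q := by
      have n1 := norm_sub_le (A (x (k + 1)) + α • z k) (αt • z (k + 1))
      have n2 := norm_add_le (A (x (k + 1))) (α • z k)
      rw [norm_smul, Real.norm_of_nonneg (hα.trans hαt).le] at n1
      rw [norm_smul, Real.norm_of_nonneg hα.le] at n2
      have n3 := mul_le_mul_of_nonneg_left (h.z_le k) hα.le
      have n4 := mul_le_mul_of_nonneg_left (h.z_le (k + 1)) (hα.trans hαt).le
      linarith
    have h4 : ‖z (0 + 1) - z (k + 1)‖ ≤ 2 * Z := by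
      have := norm_sub_le (z (0 + 1)) (z (k + 1))
      have h5 := h.z_le (0 + 1)
      have h6 := h.z_le (k + 1)
      linarith
    have h5 := mul_le_mul h3 h4 (norm_nonneg _) ((norm_nonneg _).trans h3)
    linarith
  have t4 := (abs_le.1 (hm _ (h.mem (k + 1)))).1
  have t5 : 1 / 2 * (αt - α) * ‖z (k + 1)‖ ^ 2 ≤ 1 / 2 * (αt - α) * Z ^ 2 := by
    have := h.z_le (k + 1)
    gcongr
  have t6 : 0 ≤ α / 2 * (1 + 4 * α / (αt - α)) * ‖z (k + 1) - z k‖ ^ 2 := by positivity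
  linarith

/-- Limits along subsequences are stationary, and the merit function is continuous along them. -/
theorem stationary_of_tendsto (h : IsConstStepRun S g φ f A K α αt ρ βlo βhi Z β x y z)
    (hS : IsCompact S) (hg : Proper g) (hgconv : ConvexFun g) (hglsc : LowerSemicontinuous g)
    (hf : Proper f) (hfconv : ConvexFun f) (hflsc : LowerSemicontinuous f)
    (hφ : Differentiable ℝ φ) {ℓφ : ℝ≥0} (hℓφ : LipschitzWith ℓφ (gradient φ)) (hβlo : 0 ≤ βlo)
    {κ : ℕ → ℕ} (hκ : Tendsto κ atTop atTop) {xb : E n} {yb : E p} {zb : E s}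
    (hx : Tendsto (fun j => x (κ j + 1)) atTop (𝓝 xb))
    (hy : Tendsto (fun j => y (κ j + 1)) atTop (𝓝 yb))
    (hz : Tendsto (fun j => z (κ j + 1)) atTop (𝓝 zb))
    (hD : Tendsto (stepLength x y z) atTop (𝓝 0)) :
    xb ∈ S ∧ A xb - (αt - α) • zb ∈ convSubdiff (conj g) zb ∧ K xb ∈ convSubdiff (conj f) yb ∧
      ContinuousLinearMap.adjoint K yb - ContinuousLinearMap.adjoint A zb - gradient φ xb
        ∈ normalCone S xb ∧
      ∃ cg cf : ℝ, conj g zb = cg ∧ conj f yb = cf ∧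
        Tendsto (fun j => meritSeq g φ f A K α αt x y z (κ j)) atTop
          (𝓝 (meritReal φ A K α αt xb yb zb zb cg cf)) := by
  have hDκ := hD.comp hκ
  have dx : Tendsto (fun j => x (κ j + 1) - x (κ j)) atTop (𝓝 0) :=
    squeeze_zero_norm (fun j => by
      simp only [Function.comp, stepLength]
      linarith [norm_nonneg (y (κ j + 1) - y (κ j)), norm_nonneg (z (κ j + 1) - z (κ j))]) hDκ
  have dy : Tendsto (fun j => y (κ j + 1) - y (κ j)) atTop (𝓝 0) :=
    squeeze_zero_norm (fun j => by
      simp only [Function.comp, stepLength]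
      linarith [norm_nonneg (x (κ j + 1) - x (κ j)), norm_nonneg (z (κ j + 1) - z (κ j))]) hDκ
  have dz : Tendsto (fun j => z (κ j + 1) - z (κ j)) atTop (𝓝 0) :=
    squeeze_zero_norm (fun j => by
      simp only [Function.comp, stepLength]
      linarith [norm_nonneg (x (κ j + 1) - x (κ j)), norm_nonneg (y (κ j + 1) - y (κ j))]) hDκ
  have hx0 : Tendsto (fun j => x (κ j)) atTop (𝓝 xb) := by simpa using hx.sub dx
  have hy0 : Tendsto (fun j => y (κ j)) atTop (𝓝 yb) := by simpa using hy.sub dy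
  have hz0 : Tendsto (fun j => z (κ j)) atTop (𝓝 zb) := by simpa using hz.sub dz
  have hAx := (A.continuous.tendsto xb).comp hx
  have hKx := (K.continuous.tendsto xb).comp hx
  have hxS : xb ∈ S := hS.isClosed.mem_of_tendsto hx (Eventually.of_forall fun j => h.mem _)
  have hβdy : Tendsto (fun j => β (κ j) • (y (κ j + 1) - y (κ j))) atTop (𝓝 0) := by
    have h1 := dy.norm.const_mul βhi
    rw [norm_zero, mul_zero] at h1
    refine squeeze_zero_norm (fun j => ?_) h1
    obtain ⟨hb1, hb2⟩ := h.β_mem (κ j)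
    rw [norm_smul, Real.norm_of_nonneg (hβlo.trans hb1)]
    exact mul_le_mul_of_nonneg_right hb2 (norm_nonneg _)
  obtain ⟨hgm, cg, hcg, hcgl⟩ := tendsto_of_mem_convSubdiff (proper_conj hg hgconv hglsc)
    (lowerSemicontinuous_conj hg) hz
    ((hAx.add (hz0.const_smul α)).sub (hz.const_smul αt)) (fun j => h.conj_g_eq (κ j))
    (fun j => h.z_step (κ j))
  obtain ⟨hfm, cf, hcf, hcfl⟩ := tendsto_of_mem_convSubdiff (proper_conj hf hfconv hflsc)
    (lowerSemicontinuous_conj hf) hy (hKx.sub hβdy) (fun j => h.conj_f_eq (κ j))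
    (fun j => h.y_step (κ j))
  refine ⟨hxS, ?_, by simpa using hfm, ?_, cg, cf, hcg, hcf, ?_⟩
  · convert hgm using 1
    module
  · rw [mem_normalCone_iff hxS]
    intro c hc
    have hlim : Tendsto (fun j => ⟪ρ • (x (κ j) - x (κ j + 1)) - gradient φ (x (κ j))
        + ContinuousLinearMap.adjoint K (y (κ j)) - ContinuousLinearMap.adjoint A (z (κ j)),
        c - x (κ j + 1)⟫) atTop (𝓝 ⟪ρ • (xb - xb) - gradient φ xb
        + ContinuousLinearMap.adjoint K yb - ContinuousLinearMap.adjoint A zb, c - xb⟫) := by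
      refine Tendsto.inner ?_ (tendsto_const_nhds.sub hx)
      exact ((((hx0.sub hx).const_smul ρ).sub ((hℓφ.continuous.tendsto xb).comp hx0)).add
        (((ContinuousLinearMap.adjoint K).continuous.tendsto yb).comp hy0)).sub
        (((ContinuousLinearMap.adjoint A).continuous.tendsto zb).comp hz0)
    have h1 := le_of_tendsto' hlim fun j =>
      (mem_normalCone_iff (h.mem _)).1 (h.x_step (κ j)) c hc
    have e : ρ • (xb - xb) - gradient φ xb + ContinuousLinearMap.adjoint K yb
        - ContinuousLinearMap.adjoint A zb = ContinuousLinearMap.adjoint K yb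
        - ContinuousLinearMap.adjoint A zb - gradient φ xb := by
      rw [sub_self, smul_zero]; abel
    rwa [e] at h1
  · have hφl := (hφ.continuous.tendsto xb).comp hx
    exact (((((hz.inner hAx).sub hcgl).add hφl).sub (hKx.inner hy)).add hcfl).add
      ((((hz.sub hz0).norm.pow 2).const_mul _).sub ((hz.norm.pow 2).const_mul _))

/-- Convergence of the run to a stationary point. -/
theorem exists_limit (h : IsConstStepRun S g φ f A K α αt ρ βlo βhi Z β x y z)
    (hS : IsCompact S) (hgess : EssStrictlyConvex g) (hgconv : ConvexFun g)
    (hglsc : LowerSemicontinuous g) (hf : Proper f) (hfconv : ConvexFun f)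
    (hflsc : LowerSemicontinuous f) (hK : K '' S ⊆ interior (dom f))
    (hφ : Differentiable ℝ φ) {ℓφ : ℝ≥0} (hℓφ : LipschitzWith ℓφ (gradient φ)) {γ μ : ℝ}
    (hα : 0 < α) (hαt : α < αt) (hαtγ : αt ≤ α + γ) (hαγ : α < γ / 2) (hμ : 0 < μ)
    (hβlo : 0 < βlo) (hρ : ρ = rhoOf ℓφ (sigmaMax A) γ μ α αt)
    (hKL : ∀ w : Quad n p s, (limSubdiff (merit S g φ f A K α αt) w).Nonempty →
      HasKLAt (merit S g φ f A K α αt) w) :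
    ∃ (xb : E n) (yb : E p) (zb : E s), Tendsto x atTop (𝓝 xb) ∧ Tendsto y atTop (𝓝 yb) ∧
      Tendsto z atTop (𝓝 zb) ∧ xb ∈ S ∧
      A xb - (αt - α) • zb ∈ convSubdiff (conj g) zb ∧ K xb ∈ convSubdiff (conj f) yb ∧
      ContinuousLinearMap.adjoint K yb - ContinuousLinearMap.adjoint A zb - gradient φ xb
        ∈ normalCone S xb := by
  have hρ0 : 0 ≤ ρ := by
    rw [hρ, rhoOf, sigmaMax_eq]
    have : 0 < γ := by linarith
    positivity
  set D := stepLength x y z with hDdef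
  set Hs := meritSeq g φ f A K α αt x y z with hHs
  have hD0 : ∀ k, 0 ≤ D k := fun k => by
    simp only [hDdef, stepLength]; positivity
  obtain ⟨c, hc, hdesc⟩ : ∃ c : ℝ, 0 < c ∧ ∀ k, Hs (k + 1) + c * D (k + 1) ^ 2 ≤ Hs k := by
    refine ⟨min μ (min βlo α) / 3, by positivity, fun k => ?_⟩
    refine le_trans ?_ (h.meritSeq_decrease hφ hℓφ hα hαt hαtγ hαγ hρ k)
    refine add_le_add_right ?_ _
    simp only [hDdef, stepLength]
    have m1 : min μ (min βlo α) ≤ μ := min_le_left _ _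
    have m2 : min μ (min βlo α) ≤ βlo := (min_le_right _ _).trans (min_le_left _ _)
    have m3 : min μ (min βlo α) ≤ α := (min_le_right _ _).trans (min_le_right _ _)
    have m0 : 0 < min μ (min βlo α) := by positivity
    generalize min μ (min βlo α) = m at *
    generalize ‖x (k + 1 + 1) - x (k + 1)‖ = X
    generalize ‖y (k + 1 + 1) - y (k + 1)‖ = Y
    generalize ‖z (k + 1 + 1) - z (k + 1)‖ = W
    have s1 : (X + Y + W) ^ 2 ≤ 3 * (X ^ 2 + Y ^ 2 + W ^ 2) := by
      nlinarith [sq_nonneg (X - Y), sq_nonneg (X - W), sq_nonneg (Y - W)]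
    have s2 := mul_le_mul_of_nonneg_left s1 m0.le
    have s3 := mul_le_mul_of_nonneg_right m1 (sq_nonneg X)
    have s4 := mul_le_mul_of_nonneg_right m2 (sq_nonneg Y)
    have s5 := mul_le_mul_of_nonneg_right m3 (sq_nonneg W)
    linarith
  have hanti : Antitone Hs := antitone_nat_of_succ_le fun k =>
    (le_add_of_nonneg_right (by positivity)).trans (hdesc k)
  obtain ⟨δ, B, hδ, hB⟩ := h.exists_meritSeq_ge hS hf hfconv hK hφ hα hαt
  obtain ⟨hlim, hHlim⟩ : ∃ l, Tendsto Hs atTop (𝓝 l) :=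
    ⟨_, tendsto_atTop_ciInf hanti ⟨-B, by
      rintro _ ⟨k, rfl⟩
      have := hB k
      have h1 : 0 ≤ δ * ‖y (k + 1)‖ := by positivity
      linarith⟩⟩
  have hDlim := tendsto_zero_of_sufficient_decrease hc hD0 hdesc hHlim
  -- a convergent subsequence
  obtain ⟨R, hR⟩ := hS.isBounded.exists_norm_le
  set w : ℕ → Quad n p s := fun k => quad (x (k + 1)) (y (k + 1)) (z (k + 1)) (z k) with hw
  obtain ⟨wb, -, κ, hκ, hwlim⟩ := tendsto_subseq_of_bounded
    (Metric.isBounded_closedBall (x := (0 : Quad n p s)) (r := R + (Hs 0 + B) / δ + Z + Z))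
    (x := w) (fun k => by
      rw [mem_closedBall_zero_iff]
      refine (norm_quad_le _ _ _ _).trans ?_
      have h1 : ‖y (k + 1)‖ ≤ (Hs 0 + B) / δ := by
        rw [le_div_iff₀ hδ]
        have h2 := hB k
        have h3 : Hs k ≤ Hs 0 := hanti (Nat.zero_le k)
        linarith
      have h4 := hR _ (h.mem (k + 1))
      have h5 := h.z_le (k + 1)
      have h6 := h.z_le k
      linarith)
  set xb := wb.fst with hxb
  set yb := wb.snd.fst with hyb
  set zb := wb.snd.snd.fst with hzb
  have c2 : Continuous fun w : Quad n p s => w.snd := WithLp.continuous_snd 2 _ _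
  have c22 : Continuous fun w : Quad n p s => w.snd.snd := (WithLp.continuous_snd 2 _ _).comp c2
  have hxκ : Tendsto (fun j => x (κ j + 1)) atTop (𝓝 xb) :=
    ((WithLp.continuous_fst 2 _ _).tendsto wb).comp hwlim
  have hyκ : Tendsto (fun j => y (κ j + 1)) atTop (𝓝 yb) :=
    (((WithLp.continuous_fst 2 _ _).comp c2).tendsto wb).comp hwlim
  have hzκ : Tendsto (fun j => z (κ j + 1)) atTop (𝓝 zb) :=
    (((WithLp.continuous_fst 2 _ _).comp c22).tendsto wb).comp hwlim
  have huκ : Tendsto (fun j => z (κ j)) atTop (𝓝 wb.snd.snd.snd) :=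
    (((WithLp.continuous_snd 2 _ _).comp c22).tendsto wb).comp hwlim
  obtain ⟨hxS, hgm, hfm, hNm, cg, cf, hcg, hcf, hval⟩ := h.stationary_of_tendsto hS hgess.1 hgconv
    hglsc hf hfconv hflsc hφ hℓφ hβlo.le hκ.tendsto_atTop hxκ hyκ hzκ hDlim
  have hub : wb.snd.snd.snd = zb := by
    refine tendsto_nhds_unique huκ ?_
    have dz : Tendsto (fun j => z (κ j + 1) - z (κ j)) atTop (𝓝 0) :=
      squeeze_zero_norm (fun j => by
        simp only [Function.comp, hDdef, stepLength]
        linarith [norm_nonneg (x (κ j + 1) - x (κ j)), norm_nonneg (y (κ j + 1) - y (κ j))])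
        (hDlim.comp hκ.tendsto_atTop)
    simpa using hzκ.sub dz
  have hwb : wb = quad xb yb zb wb.snd.snd.snd := rfl
  rw [hub] at hwb
  have hmb : merit S g φ f A K α αt wb = (hlim : EReal) := by
    have h1 := merit_eq (φ := φ) (A := A) (K := K) (α := α) (αt := αt) (w := quad xb yb zb zb)
      hxS hcg hcf
    rw [hwb, h1, EReal.coe_eq_coe_iff]
    exact tendsto_nhds_unique hval (hHlim.comp hκ.tendsto_atTop)
  have hmk : ∀ k, merit S g φ f A K α αt (w k) = (Hs k : EReal) := fun k =>
    merit_eq (w := w k) (h.mem (k + 1)) (h.conj_g_eq k) (h.conj_f_eq k)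
  obtain ⟨η, U, ψ, hη, hU, hwbU, hconc, hcont, hpos, hψ0, hder, -, hineq⟩ := hKL wb (by
    rw [hwb]
    exact ⟨_, frechetSubdiff_subset_limSubdiff _ _ (mem_frechetSubdiff_merit (u := zb) hgess hgconv
      hglsc hf hfconv hflsc hφ hℓφ hα hαt hxS hNm hfm hgm)⟩)
  set b := ℓφ + ρ + ‖A‖ + ‖K‖ + βhi + α + 4 * (α / 2 * (1 + 4 * α / (αt - α))) with hb
  have hb0 : 0 < b := by
    have h1 : 0 < αt - α := sub_pos.2 hαt
    have h2 : 0 < βhi := hβlo.trans_le ((h.β_mem 0).1.trans (h.β_mem 0).2)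
    positivity
  have hsum : Summable D := by
    refine summable_of_kurdyka_lojasiewicz (w := w) hb0 hc hD0 hdesc hHlim (fun k => ?_)
      (MapClusterPt.of_comp hκ.tendsto_atTop hwlim.mapClusterPt) hU hwbU hη hconc hcont hpos hψ0
      hder (fun k hkU hk hkη => ?_)
    · have h1 : w (k + 1) - w k = quad (x (k + 1 + 1) - x (k + 1)) (y (k + 1 + 1) - y (k + 1))
          (z (k + 1 + 1) - z (k + 1)) (z (k + 1) - z k) := rfl
      rw [dist_eq_norm, h1]
      refine (norm_quad_le _ _ _ _).trans ?_
      simp only [hDdef, stepLength]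
      linarith [norm_nonneg (x (k + 1) - x k), norm_nonneg (y (k + 1) - y k)]
    · have h1 := hineq (w k) hkU (by rw [hmb, hmk]; exact_mod_cast hk) (by
        rw [hmb, hmk]
        have h2 := EReal.add_lt_add_left_coe hkη hlim
        rwa [← EReal.coe_add, add_sub_cancel] at h2)
      rw [hmb, hmk, EReal.toReal_coe, EReal.toReal_coe] at h1
      obtain ⟨V, hV, hVb⟩ := h.exists_subgradient_le hgess hgconv hglsc hf hfconv hflsc hφ hℓφ hα
        hαt hρ0 hβlo.le k
      have h3 : Metric.infEDist (0 : Quad n p s) (limSubdiff (merit S g φ f A K α αt) (w k))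
          ≤ ENNReal.ofReal (b * D k) := by
        refine (Metric.infEDist_le_edist_of_mem hV).trans ?_
        rw [edist_dist, dist_zero_left]
        exact ENNReal.ofReal_le_ofReal hVb
      have h4 := h1.trans (mul_le_mul_right h3 _)
      rwa [← ENNReal.ofReal_mul' (mul_nonneg hb0.le (hD0 k)), ENNReal.one_le_ofReal] at h4
  have hconv : ∀ {F : Type} [NormedAddCommGroup F] [CompleteSpace F] {u : ℕ → F} {ub : F},
      (∀ k, ‖u (k + 1) - u k‖ ≤ D k) → Tendsto (fun j => u (κ j + 1)) atTop (𝓝 ub) →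
      Tendsto u atTop (𝓝 ub) := by
    intro F _ _ u ub hu hub
    have h1 : CauchySeq u := cauchySeq_of_dist_le_of_summable D (fun k => by
      rw [dist_comm, dist_eq_norm]; exact hu k) hsum
    obtain ⟨l, hl⟩ := cauchySeq_tendsto_of_complete h1
    have h2 := hl.comp ((tendsto_add_atTop_nat 1).comp hκ.tendsto_atTop)
    rwa [tendsto_nhds_unique hub h2]
  refine ⟨xb, yb, zb, hconv (fun k => ?_) hxκ, hconv (fun k => ?_) hyκ, hconv (fun k => ?_) hzκ,
    hxS, hgm, hfm, hNm⟩ <;> simp only [hDdef, stepLength] <;>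
    linarith [norm_nonneg (x (k + 1) - x k), norm_nonneg (y (k + 1) - y k),
      norm_nonneg (z (k + 1) - z k)]

end IsConstStepRun
end ConstStep

/-! ### The adaptive algorithm -/

section Adaptive

variable {n p s : ℕ} {S : Set (E n)} {g : E s → EReal} {φ : E n → ℝ} {f : E p → EReal}
    {A : E n →L[ℝ] E s} {K : E n →L[ℝ] E p} {α γ : ℝ}

theorem IsStepRule.le_add {a : ℕ → ℝ} (ha : IsStepRule α γ a) (j : ℕ) : a j ≤ α + γ :=
  ha.init ▸ antitone_nat_of_succ_le ha.anti (Nat.zero_le j)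

theorem rhoOf_pos {ℓφ : ℝ≥0} {μ αk : ℝ} (hγ : 0 < γ) (hμ : 0 < μ) :
    0 < rhoOf ℓφ (sigmaMax A) γ μ α αk := by
  rw [rhoOf, sigmaMax_eq]
  positivity

theorem IsAdaptiveDPFS.z_mem_convSubdiff {ℓφ μ ε : ℝ} {a β : ℕ → ℝ} {x : ℕ → E n} {y : ℕ → E p}
    {z : ℕ → E s} (hrun : IsAdaptiveDPFS S g φ f A K ℓφ α γ μ ε a β x y z)
    (hg : Proper g) (hgconv : ConvexFun g) (hglsc : LowerSemicontinuous g) (hα : 0 < α)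
    (ha : IsStepRule α γ a) (k : ℕ) :
    A (x (k + 1)) + α • z k - alphaSeq α ε a z k • z (k + 1)
      ∈ convSubdiff (conj g) (z (k + 1)) := by
  have hpos : 0 < alphaSeq α ε a z k := hα.trans (ha.gt _)
  have h1 := (hrun.z_step k).mem_convSubdiff (proper_conj hg hgconv hglsc) (convexFun_conj hg)
    (one_div_pos.2 hpos)
  generalize alphaSeq α ε a z k = c at *
  rw [one_div_one_div, smul_sub, smul_add, smul_smul, smul_smul, mul_div_cancel₀ _ hpos.ne',
    mul_one_div_cancel hpos.ne', one_smul, add_comm (α • z k)] at h1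
  exact h1

theorem IsAdaptiveDPFS.y_mem_convSubdiff {ℓφ μ ε : ℝ} {a β : ℕ → ℝ} {x : ℕ → E n} {y : ℕ → E p}
    {z : ℕ → E s} (hrun : IsAdaptiveDPFS S g φ f A K ℓφ α γ μ ε a β x y z)
    (hf : Proper f) (hfconv : ConvexFun f) (hflsc : LowerSemicontinuous f) {k : ℕ}
    (hβ : 0 < β k) :
    K (x (k + 1)) - β k • (y (k + 1) - y k) ∈ convSubdiff (conj f) (y (k + 1)) := by
  have h1 := (hrun.y_step k).mem_convSubdiff (proper_conj hf hfconv hflsc) (convexFun_conj hf)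
    (one_div_pos.2 hβ)
  rw [one_div_one_div, smul_sub, smul_add, smul_smul, mul_one_div_cancel hβ.ne', one_smul] at h1
  convert h1 using 1
  rw [smul_sub]; abel

theorem IsAdaptiveDPFS.x_mem_normalCone {ℓφ : ℝ≥0} {μ ε : ℝ} {a β : ℕ → ℝ} {x : ℕ → E n}
    {y : ℕ → E p} {z : ℕ → E s} (hrun : IsAdaptiveDPFS S g φ f A K ℓφ α γ μ ε a β x y z)
    (hS : Convex ℝ S) (hγ : 0 < γ) (hμ : 0 < μ) (k : ℕ) :
    rhoOf ℓφ (sigmaMax A) γ μ α (alphaSeq α ε a z k) • (x k - x (k + 1)) - gradient φ (x k)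
      + ContinuousLinearMap.adjoint K (y k) - ContinuousLinearMap.adjoint A (z k)
      ∈ normalCone S (x (k + 1)) := by
  have hρ : 0 < rhoOf ℓφ (sigmaMax A) γ μ α (alphaSeq α ε a z k) := rhoOf_pos hγ hμ
  have h1 := (hrun.x_step k).mem_normalCone hS hρ.le
  generalize rhoOf ℓφ (sigmaMax A) γ μ α (alphaSeq α ε a z k) = ρ at *
  rw [smul_sub, smul_add, smul_smul, mul_one_div_cancel hρ.ne', one_smul] at h1
  convert h1 using 1
  rw [smul_sub]; abel

/-- All dual variables `z` are bounded by the Lipschitz constant of `g` near `A(S)`. -/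
theorem IsAdaptiveDPFS.norm_z_le {ℓφ μ ε r : ℝ} {ℓr : ℝ≥0} {a β : ℕ → ℝ} {x : ℕ → E n}
    {y : ℕ → E p} {z : ℕ → E s} (hrun : IsAdaptiveDPFS S g φ f A K ℓφ α γ μ ε a β x y z)
    (hg : Proper g) (hgconv : ConvexFun g) (hglsc : LowerSemicontinuous g) (hα : 0 < α)
    (ha : IsStepRule α γ a) (hKr : nbhd S A r ⊆ interior (dom g))
    (hℓr : LipschitzOnWith ℓr (fun v => (g v).toReal) (nbhd S A r)) (hαr : α * ℓr < r)
    (hz0 : ‖z 0‖ ≤ ℓr) (k : ℕ) : ‖z k‖ ≤ ℓr := by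
  induction k with
  | zero => exact hz0
  | succ k ih =>
    refine norm_subgradient_le_of_lipschitz hg hgconv (w := A (x (k + 1)) + α • z k)
      (t := alphaSeq α ε a z k) (mem_nhds_nbhd (hrun.x_step k).1 ?_)
      (hKr.trans interior_subset) hℓr
      (mem_convSubdiff_of_conj hg hgconv hglsc
        (hrun.z_mem_convSubdiff hg hgconv hglsc hα ha k))
      (hα.trans (ha.gt _)) (by abel)
    rw [add_sub_cancel_left, norm_smul, Real.norm_of_nonneg hα.le]
    exact (mul_le_mul_of_nonneg_left ih hα.le).trans_lt hαr

theorem monotone_updateCount (α ε : ℝ) (a : ℕ → ℝ) (z : ℕ → E s) :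
    Monotone (updateCount α ε a z) := monotone_nat_of_le_succ fun k => by
  rw [updateCount]
  split_ifs <;> omega

/-- The parameter is lowered only finitely often. -/
theorem exists_updateCount_eq {ε Z : ℝ} {a : ℕ → ℝ} (ha : IsStepRule α γ a) (hε : 0 < ε)
    {z : ℕ → E s} (hz : ∀ k, ‖z k‖ ≤ Z) :
    ∃ j N, ∀ k ≥ N, updateCount α ε a z k = j := by
  have h1 : Tendsto (fun j => (a j - α) * Z) atTop (𝓝 0) := by
    simpa using (ha.lim.sub_const α).mul_const Z
  obtain ⟨J, hJ⟩ := (h1.eventually_le_const hε).exists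
  have hle : ∀ k, updateCount α ε a z k ≤ J := by
    intro k
    induction k with
    | zero => exact Nat.zero_le _
    | succ k ih =>
      rw [updateCount]
      split_ifs with hup
      · rcases ih.lt_or_eq with hlt | heq
        · exact hlt
        · rw [heq] at hup
          have h2 := mul_le_mul_of_nonneg_left (hz (k + 1)) (sub_pos.2 (ha.gt J)).le
          linarith
      · exact ih
  exact converges_of_monotone_of_bounded (monotone_updateCount α ε a z) hle

/-- From `A x - θ z ∈ ∂g*(z)` with `θ ‖z‖ ≤ ε` to an approximate subgradient at `A x`: the points
`A x - θ z` and `A x` both lie in the `ε`-neighbourhood of `A(S)`, where `g` is Lipschitz. -/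
theorem mem_epsSubdiff_conj_of_shift (hg : Proper g) (hgconv : ConvexFun g)
    (hglsc : LowerSemicontinuous g) {ε θ : ℝ} {ℓε : ℝ≥0} (hε : 0 ≤ ε)
    (hℓε : LipschitzOnWith ℓε (fun v => (g v).toReal) (nbhd S A ε)) {x : E n} {z : E s}
    (hx : x ∈ S) (hgx : A x ∈ dom g) (hθ : 0 ≤ θ) (hθz : θ * ‖z‖ ≤ ε)
    (h : A x - θ • z ∈ convSubdiff (conj g) z) :
    A x ∈ epsSubdiff (2 * ℓε * ε) (conj g) z := by
  have hz := mem_convSubdiff_of_conj hg hgconv hglsc h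
  obtain ⟨gq, hgq, -⟩ := mem_convSubdiff_iff.1 hz
  have hcz := conj_eq_of_mem_convSubdiff hgq hz
  obtain ⟨gx, hgx⟩ := exists_real_of_mem_dom hg (ne_of_lt hgx)
  have hdist : dist (A x - θ • z) (A x) = θ * ‖z‖ := by
    rw [dist_eq_norm, sub_sub_cancel_left, norm_neg, norm_smul, Real.norm_of_nonneg hθ]
  have hmem := mem_image_of_mem A hx
  have h1 : A x ∈ nbhd S A ε := by
    change Metric.infDist _ _ ≤ ε
    rwa [Metric.infDist_zero_of_mem hmem]
  have h2 : A x - θ • z ∈ nbhd S A ε :=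
    (Metric.infDist_le_dist_of_mem hmem).trans (hdist.trans_le hθz)
  have h3 := hℓε.dist_le_mul _ h2 _ h1
  simp only [hgq, hgx, EReal.toReal_coe, hdist, Real.dist_eq] at h3
  have h4 := (abs_le.1 h3).1
  have h5 := mul_le_mul_of_nonneg_left hθz ℓε.coe_nonneg
  refine ⟨h.1, h.2.1, fun v => ?_⟩
  refine le_trans ?_ (conj_ge hgx.le v)
  rw [hcz, ← EReal.coe_add, EReal.coe_le_coe_iff, inner_sub_right, inner_sub_right,
    inner_smul_right, real_inner_self_eq_norm_sq, real_inner_comm v, real_inner_comm z]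
  have h6 : 0 ≤ θ * ‖z‖ ^ 2 := by positivity
  have h7 : 0 ≤ ℓε * ε := by positivity
  linarith

end Adaptive

end DPFS

theorem mainTheorem1 {n p s : ℕ}
    -- the data of the program `min_{x ∈ S} g(Ax) + φ(x) - f(Kx)`
    (S : Set (DPFS.E n)) (hSne : S.Nonempty) (hSconv : Convex ℝ S) (hScpt : IsCompact S)
    (g : DPFS.E s → EReal) (hg : DPFS.Proper g) (hgconv : DPFS.ConvexFun g)
    (hglsc : LowerSemicontinuous g)
    (f : DPFS.E p → EReal) (hf : DPFS.Proper f) (hfconv : DPFS.ConvexFun f)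
    (hflsc : LowerSemicontinuous f)
    (A : DPFS.E n →L[ℝ] DPFS.E s) (K : DPFS.E n →L[ℝ] DPFS.E p)
    (φ : DPFS.E n → ℝ) (hφ : Differentiable ℝ φ)
    (ℓφ : ℝ≥0) (hℓφ : LipschitzWith ℓφ (gradient φ))
    -- `A(S)` lies in the relative interior of `dom g`; the objective is bounded below on `S`
    (hAS : A '' S ⊆ intrinsicInterior ℝ (DPFS.dom g))
    (hF : ⊥ < ⨅ x ∈ S, DPFS.objective g φ f A K x)
    -- `K(S)` lies in the relative interior of `dom f`; a neighbourhood of `A(S)` lies in `dom g`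
    (hKS : K '' S ⊆ intrinsicInterior ℝ (DPFS.dom f))
    (r : ℝ) (hr : 0 < r) (hKr : DPFS.nbhd S A r ⊆ interior (DPFS.dom g))
    (ℓr : ℝ≥0) (hℓr0 : 0 < ℓr)
    (hℓr : LipschitzOnWith ℓr (fun v => (g v).toReal) (DPFS.nbhd S A r))
    -- essential strict convexity of `g`; nonempty interior of `dom f`
    (hgess : DPFS.EssStrictlyConvex g) (hfint : (interior (DPFS.dom f)).Nonempty)
    -- the parameters
    (α γ μ ε : ℝ) (hα : 0 < α) (hαγ : α < γ / 2) (hγ : γ ≤ 2 * r / ℓr) (hμ : 0 < μ)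
    (hε : 0 < ε) (hεr : ε ≤ r)
    (ℓε : ℝ≥0) (hℓε : LipschitzOnWith ℓε (fun v => (g v).toReal) (DPFS.nbhd S A ε))
    (a : ℕ → ℝ) (ha : DPFS.IsStepRule α γ a)
    (β : ℕ → ℝ) (βlo βhi : ℝ) (hβlo : 0 < βlo) (hβ : ∀ k, βlo ≤ β k ∧ β k ≤ βhi)
    -- the generated sequence
    (x : ℕ → DPFS.E n) (y : ℕ → DPFS.E p) (z : ℕ → DPFS.E s)
    (hz0 : ‖z 0‖ ≤ ℓr)
    (hrun : DPFS.IsAdaptiveDPFS S g φ f A K ℓφ α γ μ ε a β x y z)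
    -- the KL property of the merit function for the eventual value `αt` of the parameters `α_k`
    (hKL : ∀ αt : ℝ, (∀ᶠ k in Filter.atTop, DPFS.alphaSeq α ε a z k = αt) →
      ∀ w : DPFS.Quad n p s,
        (DPFS.limSubdiff (DPFS.merit S g φ f A K α αt) w).Nonempty →
          DPFS.HasKLAt (DPFS.merit S g φ f A K α αt) w) :
    ∃ (xb : DPFS.E n) (yb : DPFS.E p) (zb : DPFS.E s),
      Filter.Tendsto x Filter.atTop (nhds xb) ∧
      Filter.Tendsto y Filter.atTop (nhds yb) ∧
      Filter.Tendsto z Filter.atTop (nhds zb) ∧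
      DPFS.IsApproxKKT S g φ f A K (2 * ℓε * ε) xb yb zb := by
  have hℓr' : (0 : ℝ) < ℓr := hℓr0
  have hγ0 : 0 < γ := by linarith
  -- `A x + α z` stays strictly inside the `r`-neighbourhood of `A(S)` while `‖z‖ ≤ ℓr`
  have hαr : α * ℓr < r := by
    rw [le_div_iff₀ hℓr'] at hγ
    nlinarith
  have hz := hrun.norm_z_le hg hgconv hglsc hα ha hKr hℓr hαr hz0
  obtain ⟨j, N, hj⟩ := DPFS.exists_updateCount_eq (γ := γ) ha hε hz
  have hαk : ∀ k, N ≤ k → DPFS.alphaSeq α ε a z k = a j := fun k hk => by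
    rw [DPFS.alphaSeq, hj k hk]
  have hzε : ∀ k, N ≤ k → (a j - α) * ‖z (k + 1)‖ ≤ ε := fun k hk => by
    -- otherwise the parameter would be lowered once more
    by_contra hcon
    have h1 := hj (k + 1) (by omega)
    rw [DPFS.updateCount, hj k hk, if_pos (not_le.1 hcon)] at h1
    omega
  -- the shift by `N + 1` makes the parameter constant and puts every `x k` into `S`
  have hconst : DPFS.IsConstStepRun S g φ f A K α (a j)
      (DPFS.rhoOf ℓφ (DPFS.sigmaMax A) γ μ α (a j)) βlo βhi ℓr (fun k => β (k + (N + 1)))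
      (fun k => x (k + (N + 1))) (fun k => y (k + (N + 1))) (fun k => z (k + (N + 1))) :=
    { mem := fun k => (hrun.x_step (k + N)).1
      z_le := fun k => hz _
      β_mem := fun k => hβ _
      x_step := fun k => by
        have h1 := hrun.x_mem_normalCone hSconv hγ0 hμ (k + (N + 1))
        rw [hαk _ (by omega)] at h1
        rw [Nat.add_right_comm k 1]
        exact h1
      y_step := fun k => by
        rw [Nat.add_right_comm k 1]
        exact hrun.y_mem_convSubdiff hf hfconv hflsc (hβlo.trans_le (hβ _).1)
      z_step := fun k => by
        have h1 := hrun.z_mem_convSubdiff hg hgconv hglsc hα ha (k + (N + 1))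
        rw [hαk _ (by omega)] at h1
        rw [Nat.add_right_comm k 1]
        exact h1 }
  obtain ⟨xb, yb, zb, hx, hy, hzl, hxS, hgm, hfm, hNm⟩ := hconst.exists_limit hScpt hgess hgconv
    hglsc hf hfconv hflsc (hKS.trans (DPFS.intrinsicInterior_subset_interior hfint)) hφ hℓφ hα
    (ha.gt j) (ha.le_add j) hαγ hμ hβlo rfl
    (hKL (a j) (Filter.eventually_atTop.2 ⟨N, fun k hk => hαk k hk⟩))
  have hzl' := (Filter.tendsto_add_atTop_iff_nat (N + 1)).1 hzl
  refine ⟨xb, yb, zb, (Filter.tendsto_add_atTop_iff_nat (N + 1)).1 hx,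
    (Filter.tendsto_add_atTop_iff_nat (N + 1)).1 hy, hzl', ?_, hfm, _, hNm, by abel⟩
  refine DPFS.mem_epsSubdiff_conj_of_shift hg hgconv hglsc hε.le hℓε hxS ?_
    (sub_pos.2 (ha.gt j)).le ?_ hgm
  · refine interior_subset (hKr ?_)
    change Metric.infDist _ _ ≤ r
    rw [Metric.infDist_zero_of_mem (Set.mem_image_of_mem A hxS)]
    exact hr.le
  · exact le_of_tendsto (hzl.norm.const_mul (a j - α))
      (Filter.Eventually.of_forall fun k => hzε (k + N) (by omega))
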